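/- **Theorem (two-weight theorem for $t$-Haar multipliers).** A weight is a locally integrable, almost everywhere positive function on $\mathbb R$; $L^2(u)=L^2(\mathbb R,u\,dx)$ (complex-valued functions). Let $\mathcal D$ be the collection of dyadic intervals $[2^{-j}k,2^{-j}(k+1))$, $j,k\in\mathbb Z$; let $I_-$, $I_+$ be the left and right halves of $I\in\mathcal D$, $\langle f\rangle_I=\frac1{|I|}\int_I f$ (with values in $[0,\infty]$ for $f\ge 0$), $\Delta_I f=\langle f\rangle_{I_+}-\langle f\rangle_{I_-}$, and $h_I=|I|^{-1/2}(\mathbf 1_{I_+}-\mathbf 1_{I_-})$. For a weight $w$, $t\in\mathbb R$ and signs $\sigma=(\sigma_I)_{I\in\mathcal D}$, $\sigma_I=\pm1$, let $$T^t_{w,\sigma}f(x)=\sum_{I\in\mathcal D}\sigma_I\Big(\frac{w(x)}{\langle w\rangle_I}\Big)^t\langle f,h_I\rangle h_I(x).$$ An operator given by a series indexed by $\mathcal D$ is called bounded from $L^2(u)$ into $L^2(v)$ if every $f\in L^2(u)$ is locally integrable, the terms of the series lie in $L^2(v)$, the series converges unconditionally in $L^2(v)$ for every $f\in L^2(u)$,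 and its sum defines a bounded linear operator; otherwise its norm is $\infty$. Let $t\in\mathbb R$ and let $u,v,w$ be weights. The operators $T^t_{w,\sigma}$ are bounded from $L^2(u)$ into $L^2(v)$ uniformly in $\sigma$ if and only if the following four conditions hold. (i) $\displaystyle C_1:=\sup_{I\in\mathcal D}\frac{\langle u^{-1}\rangle_I\,\langle vw^{2t}\rangle_I}{\langle w\rangle_I^{2t}}<\infty$ (so that $u^{-1}$ and $vw^{2t}$ are integrable on dyadic intervals). (ii) There is a finite constant $C_2\ge 0$ such that for all $I\in\mathcal D$ $$\frac1{|I|}\sum_{J\in\mathcal D,\,J\subset I}|J|\,|\Delta_J u^{-1}|^2\,\frac{\langle vw^{2t}\rangle_J}{\langle w\rangle_J^{2t}}\le C_2\,\langle u^{-1}\rangle_I .$$ (iii) There is a finite constant $C_3\ge 0$ such that for all $I\in\mathcal D$ $$\frac1{|I|}\sum_{J\in\mathcal D,\,J\subset I}|J|\,|\Delta_J (vw^{2t})|^2\,\frac{\langle u^{-1}\rangle_J}{\langle w\rangle_J^{2t}}\le C_3\,\langle vw^{2t}\rangle_I .$$ (iv) The positive operator $$P^t_{w,\lambda}f(x)=\sum_{I\in\mathcal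 D}\frac{w^t(x)}{|I|}\,\lambda_I\,\langle f\rangle_I\,\mathbf 1_I(x),\qquad \lambda_I=\frac{|\Delta_I(vw^{2t})|}{\langle vw^{2t}\rangle_I}\,\frac{|\Delta_I u^{-1}|}{\langle u^{-1}\rangle_I}\,\frac{|I|}{\langle w\rangle_I^{t}},$$ is bounded from $L^2(u)$ into $L^2(v)$, with operator norm $C_4$. Moreover, let $C_2,C_3$ denote the least constants in (ii), (iii) (each of $C_1,\dots,C_4$ being $\infty$ if the corresponding condition fails, and the sum below being $\infty$ whenever $C_1=\infty$). There are absolute constants $c,K>0$, independent of $t,u,v,w,\sigma$, such that for every individual choice of signs $\sigma$ $$\|T^t_{w,\sigma}\|_{L^2(u)\to L^2(v)}\le K\big(\sqrt{C_1}+\sqrt{C_2}+\sqrt{C_3}+C_4\big)$$ (in particular (i)--(iv) imply that each individual $T^t_{w,\sigma}$ is bounded), and $$c\,\big(\sqrt{C_1}+\sqrt{C_2}+\sqrt{C_3}+C_4\big)\le\sup_{\sigma}\|T^t_{w,\sigma}\|_{L^2(u)\to L^2(v)} .$$ -/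

import Mathlib

open MeasureTheory Set
open scoped NNReal ENNReal

noncomputable section

namespace THaar

/-- A weight on the real line: a locally integrable, almost everywhere positive function. -/
structure IsWeight (w : ℝ → ℝ) : Prop where
  locallyIntegrable : LocallyIntegrable w volume
  ae_pos : ∀ᵐ x ∂(volume : Measure ℝ), 0 < w x

/-- The measure `u(x) dx`. -/
def weightMeasure (u : ℝ → ℝ) : Measure ℝ :=
  volume.withDensity (fun x => ENNReal.ofReal (u x))

/-- The complex Hilbert space `L²(u) = L²(ℝ, u(x) dx)`. -/
abbrev L2 (u : ℝ → ℝ) : Type := Lp ℂ 2 (weightMeasure u)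

/-- Labels of the standard dyadic intervals: `(j, k)` stands for `[2⁻ʲ k, 2⁻ʲ (k + 1))`.
Different labels give different intervals. -/
abbrev DyadicLabel : Type := ℤ × ℤ

/-- The length `|I|`. -/
def len (I : DyadicLabel) : ℝ := (2 : ℝ) ^ (-I.1)

/-- The interval itself, as a set of real numbers. -/
def ivl (I : DyadicLabel) : Set ℝ :=
  Ico ((2 : ℝ) ^ (-I.1) * (I.2 : ℝ)) ((2 : ℝ) ^ (-I.1) * ((I.2 : ℝ) + 1))

/-- The left half `I₋`. -/
def left (I : DyadicLabel) : DyadicLabel := (I.1 + 1, 2 * I.2)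

/-- The right half `I₊`. -/
def right (I : DyadicLabel) : DyadicLabel := (I.1 + 1, 2 * I.2 + 1)

/-- The average `⟨f⟩_I` of a real or complex function that is integrable on `I`. -/
def avg {E : Type} [NormedAddCommGroup E] [NormedSpace ℝ E] (f : ℝ → E) (I : DyadicLabel) : E :=
  (len I)⁻¹ • ∫ x in ivl I, f x

/-- The average `⟨a⟩_I ∈ [0, ∞]` of an almost everywhere non-negative function `a`;
it is infinite when `a` is not integrable on `I`. -/
def eavg (a : ℝ → ℝ) (I : DyadicLabel) : ℝ≥0∞ :=
  (∫⁻ x in ivl I, ENNReal.ofReal (a x)) / ENNReal.ofReal (len I)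

/-- `Δ_I a = ⟨a⟩_{I₊} - ⟨a⟩_{I₋}`. -/
def delta (a : ℝ → ℝ) (I : DyadicLabel) : ℝ := avg a (right I) - avg a (left I)

/-- The Haar function `h_I = |I|^{-1/2} (1_{I₊} - 1_{I₋})`. -/
def haar (I : DyadicLabel) (x : ℝ) : ℝ :=
  (Real.sqrt (len I))⁻¹ *
    ((ivl (right I)).indicator (fun _ => (1 : ℝ)) x - (ivl (left I)).indicator (fun _ => (1 : ℝ)) x)

/-- The Haar coefficient `⟨f, h_I⟩` (the Haar function is real-valued). -/
def haarCoeff (f : ℝ → ℂ) (I : DyadicLabel) : ℂ := ∫ x, f x * (haar I x : ℂ)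

/-- The `I`-th term of the `t`-Haar multiplier `T^t_{w,σ} f`,
`σ_I (w(x) / ⟨w⟩_I)^t ⟨f, h_I⟩ h_I(x)`, with signs `σ_I ∈ {1, -1} = ℤˣ`. -/
def haarTerm (t : ℝ) (w : ℝ → ℝ) (σ : DyadicLabel → ℤˣ) (I : DyadicLabel) (f : ℝ → ℂ) (x : ℝ) : ℂ :=
  ((σ I : ℤ) : ℂ) * (((w x / avg w I) ^ t : ℝ) : ℂ) * haarCoeff f I * (haar I x : ℂ)

/-- The pointwise inverse `u⁻¹ = 1 / u` of a weight. -/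
def invW (u : ℝ → ℝ) (x : ℝ) : ℝ := (u x)⁻¹

/-- The function `v w^{2t}`. -/
def vw (t : ℝ) (v w : ℝ → ℝ) (x : ℝ) : ℝ := v x * (w x) ^ (2 * t)

/-- `λ_I = (|Δ_I(v w^{2t})| / ⟨v w^{2t}⟩_I) (|Δ_I(u⁻¹)| / ⟨u⁻¹⟩_I) (|I| / ⟨w⟩_I^t)`. -/
def lam (t : ℝ) (u v w : ℝ → ℝ) (I : DyadicLabel) : ℝ :=
  (|delta (vw t v w) I| / avg (vw t v w) I) * (|delta (invW u) I| / avg (invW u) I) *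
    (len I / (avg w I) ^ t)

/-- The `I`-th term of the positive operator `P^t_{w,λ} f`,
`(w(x)^t / |I|) λ_I ⟨f⟩_I 1_I(x)`. -/
def posTerm (t : ℝ) (u v w : ℝ → ℝ) (I : DyadicLabel) (f : ℝ → ℂ) (x : ℝ) : ℂ :=
  (((w x) ^ t / len I * lam t u v w I : ℝ) : ℂ) * avg f I * (ivl I).indicator (fun _ => (1 : ℂ)) x

/-- The series `f ↦ ∑_I A_I f` defines the bounded operator `L` from `L²(u)` into `L²(v)`:
every `f ∈ L²(u)` is integrable on dyadic intervals (so that averages and Haar coefficients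
make sense), every term `A_I f` lies in `L²(v)`, and the series of the terms converges
(unconditionally) in `L²(v)` to `L f`. Such an `L` is unique if it exists. -/
def Represents (A : DyadicLabel → (ℝ → ℂ) → ℝ → ℂ) (u v : ℝ → ℝ) (L : L2 u →L[ℂ] L2 v) : Prop :=
  ∀ f : L2 u, (∀ I, IntegrableOn (f : ℝ → ℂ) (ivl I) volume) ∧
    ∃ h : ∀ I, MemLp (A I f) 2 (weightMeasure v), HasSum (fun I => (h I).toLp (A I f)) (L f)

/-- The operator `f ↦ ∑_I A_I f` is bounded from `L²(u)` into `L²(v)`. -/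
def IsBoundedOp (A : DyadicLabel → (ℝ → ℂ) → ℝ → ℂ) (u v : ℝ → ℝ) : Prop :=
  ∃ L : L2 u →L[ℂ] L2 v, Represents A u v L

/-- The norm from `L²(u)` to `L²(v)` of the operator `f ↦ ∑_I A_I f`
(infinite if it is not a bounded operator). -/
def opNorm (A : DyadicLabel → (ℝ → ℂ) → ℝ → ℂ) (u v : ℝ → ℝ) : ℝ≥0∞ :=
  ⨅ (L : L2 u →L[ℂ] L2 v) (_ : Represents A u v L), ‖L‖ₑ

/-- The operators `T^t_{w,σ}` are bounded from `L²(u)` into `L²(v)`, uniformly in the signs. -/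
def UniformlyBounded (t : ℝ) (u v w : ℝ → ℝ) : Prop :=
  ∃ C : ℝ≥0, ∀ σ : DyadicLabel → ℤˣ,
    ∃ L : L2 u →L[ℂ] L2 v, Represents (haarTerm t w σ) u v L ∧ ‖L‖ ≤ C

/-- `C₁ = sup_I ⟨u⁻¹⟩_I ⟨v w^{2t}⟩_I / ⟨w⟩_I^{2t}`, in `[0, ∞]`. -/
def jointConst (t : ℝ) (u v w : ℝ → ℝ) : ℝ≥0∞ :=
  ⨆ I : DyadicLabel, eavg (invW u) I * eavg (vw t v w) I / ENNReal.ofReal ((avg w I) ^ (2 * t))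

/-- The least constant `C ∈ [0, ∞]` such that for all dyadic `I`
`|I|⁻¹ ∑_{J ⊆ I} |J| |Δ_J a|² ⟨b⟩_J / ⟨w⟩_J^{2t} ≤ C ⟨a⟩_I`; it is meaningful for locally
integrable `a`, `b`. -/
def carlesonConst (t : ℝ) (a b w : ℝ → ℝ) : ℝ≥0∞ :=
  sInf {C : ℝ≥0∞ | ∀ I : DyadicLabel,
    (ENNReal.ofReal (len I))⁻¹ * ∑' J : {J : DyadicLabel // ivl J ⊆ ivl I},
      ENNReal.ofReal (len J * |delta a J| ^ 2 * (avg b J / (avg w J) ^ (2 * t))) ≤ C * eavg a I}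

/-- `C₂`, the best constant in the Carleson condition. -/
def C₂ (t : ℝ) (u v w : ℝ → ℝ) : ℝ≥0∞ := carlesonConst t (invW u) (vw t v w) w

/-- `C₃`, the best constant in the dual Carleson condition. -/
def C₃ (t : ℝ) (u v w : ℝ → ℝ) : ℝ≥0∞ := carlesonConst t (vw t v w) (invW u) w

/-- `√C₁ + √C₂ + √C₃ + C₄`, where `C₄` is the norm of `P^t_{w,λ}`. -/
def constSum (t : ℝ) (u v w : ℝ → ℝ) : ℝ≥0∞ :=
  jointConst t u v w ^ (1 / 2 : ℝ) + C₂ t u v w ^ (1 / 2 : ℝ) + C₃ t u v w ^ (1 / 2 : ℝ) +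
    opNorm (posTerm t u v w) u v

end THaar

end

/-! Everything is read off two families of vectors indexed by dyadic intervals: `i_I = 1_I u⁻¹` in
`L²(u)` and `l_I = 1_I w^t` in `L²(v)`. Then `⟨i_I, f⟩ = ∫_I f`, the squared norms are the integrals
of `u⁻¹` and `v w^{2t}` over `I`, and the Haar term is `σ_I s_I ⟨i_{I₊} - i_{I₋}, f⟩ (l_{I₊} -
l_{I₋})` with `s_I = ⟨w⟩_I^{-t} / |I|`. Likewise the positive term is `p_I ⟨i_I, f⟩ l_I` with `p_I =
λ_I / |I|²`. The argument uses only that each family is additive under halving, orthogonal within a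
generation, and nonzero (`DyadicSystem`), until positivity of functions is needed for `P`.

The coefficient `⟨i_{I₊} - i_{I₋}, f⟩` is a mean part, proportional to `⟨i_I, f⟩`, plus an
oscillating part bounded by `‖i_I‖` times the root of an energy (`norm_inner_sub_mean_le`). Energies
telescope, so they sum to at most `‖f‖²` (`sum_energy_le`).

Sufficiency: splitting both coefficients of the bilinear form gives four sums. Oscillation against
oscillation is Cauchy–Schwarz with `C₁`; the two mixed sums use the Carleson embedding
(`carleson_embedding`, by a Bellman function) with `C₂` and `C₃`; mean against mean is the form of
`P`. Absolute values are bounded throughout, so every choice of signs is covered.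

Necessity: free signs turn a norm bound `M` into a square function bound (`sum_sq_le`) and an
absolute bilinear bound (`SignedBound.sum_coeff_mul_coeff_le`). Testing the former on `i_{I₊} -
i_{I₋}` and on `i_I`, and dualizing, gives (i)–(iii). Solving the decomposition for the mean parts
gives (iv). Local integrability of `u⁻¹` and `v w^{2t}` is obtained beforehand from single terms
tested on truncations (`integrableOn_of_bounds`). -/

namespace THaar

/-! ### Signs and unconditional convergence in Hilbert space -/

/-- Choosing signs so that squared norms add up: one of `‖a ± b‖²` is at least `‖a‖² + ‖b‖²`. -/
theorem exists_sign_add_sq_le {H : Type*} [NormedAddCommGroup H] [InnerProductSpace ℂ H] (a b : H) :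
    ∃ e : ℤˣ, ‖a‖ ^ 2 + ‖b‖ ^ 2 ≤ ‖a + ((e : ℤ) : ℂ) • b‖ ^ 2 := by
  by_cases h : 0 ≤ RCLike.re (inner ℂ a b)
  · refine ⟨1, ?_⟩
    have := @norm_add_sq ℂ H _ _ _ a b
    simp only [Units.val_one, Int.cast_one, one_smul]
    linarith
  · refine ⟨-1, ?_⟩
    have := @norm_sub_sq ℂ H _ _ _ a b
    simp only [Units.val_neg, Units.val_one, Int.cast_neg, Int.cast_one, neg_smul, one_smul,
      ← sub_eq_add_neg]
    linarith

/-- A greedy form of averaging over random signs: each new vector receives the sign that makes its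
cross term with the current sum nonnegative. -/
theorem exists_signs_sum_sq_le {ι H : Type*} [DecidableEq ι] [NormedAddCommGroup H]
    [InnerProductSpace ℂ H] (z : ι → H) (F : Finset ι) :
    ∃ e : ι → ℤˣ, ∑ J ∈ F, ‖z J‖ ^ 2 ≤ ‖∑ J ∈ F, ((e J : ℤ) : ℂ) • z J‖ ^ 2 := by
  induction F using Finset.induction_on with
  | empty => exact ⟨1, by simp⟩
  | insert J F hJ ih =>
    obtain ⟨e, he⟩ := ih
    obtain ⟨d, hd⟩ := exists_sign_add_sq_le (∑ J ∈ F, ((e J : ℤ) : ℂ) • z J) (z J)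
    refine ⟨Function.update e J d, ?_⟩
    rw [Finset.sum_insert hJ, Finset.sum_insert hJ]
    have : ∑ x ∈ F, ((Function.update e J d x : ℤ) : ℂ) • z x = ∑ x ∈ F, ((e x : ℤ) : ℂ) • z x :=
      Finset.sum_congr rfl fun x hx => by
        rw [Function.update_of_ne (ne_of_mem_of_not_mem hx hJ)]
    rw [this, Function.update_self, add_comm (_ • z J)]
    linarith

/-- In a Hilbert space a series with bounded finite partial sums converges unconditionally. -/
theorem summable_of_norm_sum_le {ι H : Type*} [NormedAddCommGroup H] [InnerProductSpace ℂ H]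
    [CompleteSpace H] {z : ι → H} {C : ℝ} (hz : ∀ F : Finset ι, ‖∑ J ∈ F, z J‖ ≤ C) :
    Summable z := by
  classical
  rw [summable_iff_vanishing_norm]
  by_contra! hcon
  obtain ⟨ε, hε, hcon⟩ := hcon
  -- If the Cauchy criterion fails, there are disjoint blocks of norm at least `ε`; signing whole
  -- blocks greedily raises the squared norm by `ε²` each time.
  have key : ∀ n : ℕ, ∃ (F : Finset ι) (e : ι → ℤˣ),
      n * ε ^ 2 ≤ ‖∑ J ∈ F, ((e J : ℤ) : ℂ) • z J‖ ^ 2 := by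
    intro n
    induction n with
    | zero => exact ⟨∅, 1, by simp⟩
    | succ n ih =>
      obtain ⟨F, e, he⟩ := ih
      obtain ⟨G, hG, hGε⟩ := hcon F
      obtain ⟨d, hd⟩ := exists_sign_add_sq_le (∑ J ∈ F, ((e J : ℤ) : ℂ) • z J) (∑ J ∈ G, z J)
      refine ⟨F ∪ G, fun J => if J ∈ F then e J else d, ?_⟩
      rw [Finset.sum_union hG.symm]
      have h1 : ∑ x ∈ F, (((if x ∈ F then e x else d : ℤˣ) : ℤ) : ℂ) • z x
          = ∑ x ∈ F, ((e x : ℤ) : ℂ) • z x :=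
        Finset.sum_congr rfl fun x hx => by rw [if_pos hx]
      have h2 : ∑ x ∈ G, (((if x ∈ F then e x else d : ℤˣ) : ℤ) : ℂ) • z x
          = ((d : ℤ) : ℂ) • ∑ x ∈ G, z x := by
        rw [Finset.smul_sum]
        exact Finset.sum_congr rfl fun x hx => by
          rw [if_neg (Finset.disjoint_left.1 hG hx)]
      rw [h1, h2]
      have : ε ^ 2 ≤ ‖∑ J ∈ G, z J‖ ^ 2 := by gcongr
      push_cast
      linarith
  -- On the other hand, a signed sum is a difference of two plain sums, each bounded by `C`.
  have bound : ∀ (F : Finset ι) (e : ι → ℤˣ), ‖∑ J ∈ F, ((e J : ℤ) : ℂ) • z J‖ ≤ 2 * C := by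
    intro F e
    rw [← Finset.sum_filter_add_sum_filter_not F (fun J => e J = 1)]
    have h1 : ∑ x ∈ F with e x = 1, ((e x : ℤ) : ℂ) • z x = ∑ x ∈ F with e x = 1, z x :=
      Finset.sum_congr rfl fun x hx => by rw [(Finset.mem_filter.1 hx).2]; simp
    have h2 : ∑ x ∈ F with ¬ e x = 1, ((e x : ℤ) : ℂ) • z x = - ∑ x ∈ F with ¬ e x = 1, z x := by
      rw [← Finset.sum_neg_distrib]
      exact Finset.sum_congr rfl fun x hx => by
        rw [(Int.units_eq_one_or (e x)).resolve_left (Finset.mem_filter.1 hx).2]; simp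
    rw [h1, h2]
    refine (norm_add_le _ _).trans ?_
    rw [norm_neg]
    linarith [hz (F.filter fun x => e x = 1), hz (F.filter fun x => ¬ e x = 1)]
  obtain ⟨n, hn⟩ := exists_nat_gt ((2 * C) ^ 2 / ε ^ 2)
  obtain ⟨F, e, he⟩ := key n
  have h1 := bound F e
  have h2 : ‖∑ J ∈ F, ((e J : ℤ) : ℂ) • z J‖ ^ 2 ≤ (2 * C) ^ 2 := by gcongr
  rw [div_lt_iff₀ (by positivity)] at hn
  linarith

/-- A family of operators with uniformly bounded finite partial sums has a bounded sum. -/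
theorem exists_clm_hasSum {ι E H : Type*} [NormedAddCommGroup E] [InnerProductSpace ℂ E]
    [NormedAddCommGroup H] [InnerProductSpace ℂ H] [CompleteSpace H] (S : ι → E →ₗ[ℂ] H) {C : ℝ}
    (hC : 0 ≤ C) (hS : ∀ (F : Finset ι) (f : E), ‖∑ J ∈ F, S J f‖ ≤ C * ‖f‖) :
    ∃ L : E →L[ℂ] H, ‖L‖ ≤ C ∧ ∀ f, HasSum (fun J => S J f) (L f) := by
  have hs : ∀ f, Summable fun J => S J f := fun f => summable_of_norm_sum_le fun F => hS F f
  let L₀ : E →ₗ[ℂ] H :=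
    { toFun := fun f => ∑' J, S J f
      map_add' := fun f g => by
        simp only [map_add]
        exact (hs f).tsum_add (hs g)
      map_smul' := fun c f => by
        simp only [map_smul, RingHom.id_apply]
        exact (hs f).tsum_const_smul c }
  have hL : ∀ f, ‖L₀ f‖ ≤ C * ‖f‖ := fun f =>
    le_of_tendsto (hs f).hasSum.norm (Filter.Eventually.of_forall fun F => hS F f)
  exact ⟨L₀.mkContinuous C hL, L₀.mkContinuous_norm_le hC hL, fun f => (hs f).hasSum⟩

/-- If all signed series have sums bounded by `M`, so do all signed finite partial sums. -/
theorem norm_signed_sum_le {ι H : Type*} [NormedAddCommGroup H] [NormedSpace ℂ H]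
    {z : ι → H} {M : ℝ}
    (hz : ∀ σ : ι → ℤˣ, ∃ y, HasSum (fun J => ((σ J : ℤ) : ℂ) • z J) y ∧ ‖y‖ ≤ M)
    (F : Finset ι) (e : ι → ℤˣ) : ‖∑ J ∈ F, ((e J : ℤ) : ℂ) • z J‖ ≤ M := by
  classical
  obtain ⟨y₁, h₁, n₁⟩ := hz e
  -- Flipping all signs outside `F` makes the two series cancel there and double on `F`.
  obtain ⟨y₂, h₂, n₂⟩ := hz fun J => if J ∈ F then e J else - e J
  have h := (h₁.add h₂)
  have h' : HasSum (fun J => ((e J : ℤ) : ℂ) • z J +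
      (((if J ∈ F then e J else - e J : ℤˣ) : ℤ) : ℂ) • z J)
      (∑ J ∈ F, (((e J : ℤ) : ℂ) • z J +
      (((if J ∈ F then e J else - e J : ℤˣ) : ℤ) : ℂ) • z J)) := by
    refine hasSum_sum_of_ne_finset_zero fun J hJ => ?_
    rw [if_neg hJ]
    simp
  have h3 : y₁ + y₂ = (2 : ℂ) • ∑ J ∈ F, ((e J : ℤ) : ℂ) • z J := by
    rw [h.unique h', Finset.smul_sum]
    exact Finset.sum_congr rfl fun J hJ => by rw [if_pos hJ, two_smul]
  have h4 : ‖y₁ + y₂‖ = 2 * ‖∑ J ∈ F, ((e J : ℤ) : ℂ) • z J‖ := by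
    rw [h3, norm_smul]; simp
  linarith [norm_add_le y₁ y₂]

/-! ### Telescoping over dyadic generations -/

theorem sum_Ico_two_mul (f : ℤ → ℝ) (a b : ℤ) :
    ∑ k ∈ Finset.Ico (2 * a) (2 * b), f k = ∑ k ∈ Finset.Ico a b, (f (2 * k) + f (2 * k + 1)) := by
  have h : Finset.Ico (2 * a) (2 * b) = (Finset.Ico a b).image (fun k => 2 * k) ∪
      (Finset.Ico a b).image (fun k => 2 * k + 1) := by
    ext k
    simp only [Finset.mem_Ico, Finset.mem_union, Finset.mem_image]
    constructor
    · intro hk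
      rcases Int.even_or_odd' k with ⟨c, hc | hc⟩
      · exact Or.inl ⟨c, by omega, hc.symm⟩
      · exact Or.inr ⟨c, by omega, hc.symm⟩
    · rintro (⟨c, hc, rfl⟩ | ⟨c, hc, rfl⟩) <;> omega
  rw [h, Finset.sum_union, Finset.sum_image, Finset.sum_image, Finset.sum_add_distrib]
  · intro x _ y _ hxy; simpa using hxy
  · intro x _ y _ hxy; simpa using hxy
  · rw [Finset.disjoint_left]
    simp only [Finset.mem_image, not_exists, not_and]
    rintro k ⟨c, -, rfl⟩ d -
    omega

/-- Telescoping over generations: a non-negative `g` dominated by the increments of a potential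
`ψ`, whose sums over a generation are at most `N`, has sum at most `N`. -/
theorem sum_le_of_telescoping {g ψ : DyadicLabel → ℝ} {N : ℝ} (hg : ∀ I, 0 ≤ g I)
    (hψ : ∀ I, 0 ≤ ψ I) (h : ∀ I, g I + ψ I ≤ ψ (left I) + ψ (right I))
    (hN : ∀ (j : ℤ) (K : Finset ℤ), ∑ k ∈ K, ψ (j, k) ≤ N) (F : Finset DyadicLabel) :
    ∑ I ∈ F, g I ≤ N := by
  obtain ⟨R, hR⟩ : ∃ R : ℕ, ∀ I ∈ F, |I.1| < R ∧ |I.2| < R := by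
    refine ⟨F.sup (fun I : DyadicLabel => I.1.natAbs + I.2.natAbs) + 1, fun I hI => ?_⟩
    have := Finset.le_sup (f := fun I : DyadicLabel => I.1.natAbs + I.2.natAbs) hI
    rw [Int.abs_eq_natAbs, Int.abs_eq_natAbs]
    omega
  -- Start from the intervals of generation `-R` with positions in `[-R, R)`; after `m` halvings
  -- their descendants have positions in `[-2^m R, 2^m R)`. This range only grows, so `2R`
  -- generations capture all of `F`.
  have tele : ∀ n : ℕ, ∑ m ∈ Finset.range n, ∑ k ∈ Finset.Ico (2 ^ m * (-R : ℤ)) (2 ^ m * R),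
      g (-R + m, k) ≤ ∑ k ∈ Finset.Ico (2 ^ n * (-R : ℤ)) (2 ^ n * R), ψ (-R + n, k) := by
    intro n
    induction n with
    | zero => simpa using Finset.sum_nonneg fun k _ => hψ _
    | succ n ih =>
      rw [Finset.sum_range_succ, pow_succ', mul_assoc, mul_assoc, sum_Ico_two_mul]
      refine (add_le_add_left ih _).trans ?_
      rw [← Finset.sum_add_distrib]
      refine Finset.sum_le_sum fun k _ => ?_
      have := h (-R + n, k)
      simp only [left, right] at this
      push_cast
      rw [← add_assoc]
      linarith
  have hsub : F ⊆ (Finset.range (2 * R)).biUnion fun m =>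
      (Finset.Ico (2 ^ m * (-R : ℤ)) (2 ^ m * R)).image fun k => ((-R + m, k) : DyadicLabel) := by
    intro I hI
    obtain ⟨h1, h2⟩ := hR I hI
    rw [abs_lt] at h1 h2
    simp only [Finset.mem_biUnion, Finset.mem_range, Finset.mem_image, Finset.mem_Ico]
    refine ⟨(I.1 + R).toNat, by omega, I.2, ?_, ?_⟩
    · have : (1 : ℤ) ≤ 2 ^ (I.1 + R).toNat := one_le_pow₀ (by norm_num)
      constructor <;> nlinarith
    · ext
      · simp; omega
      · rfl
  refine (Finset.sum_le_sum_of_subset_of_nonneg hsub fun I _ _ => hg I).trans ?_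
  rw [Finset.sum_biUnion]
  · refine (le_of_eq ?_).trans ((tele (2 * R)).trans ?_)
    · refine Finset.sum_congr rfl fun m _ => ?_
      rw [Finset.sum_image]
      intro x _ y _ hxy
      exact (Prod.ext_iff.1 hxy).2
    · exact hN _ _
  · intro m _ m' _ hmm
    simp only [Function.onFun]
    rw [Finset.disjoint_left]
    simp only [Finset.mem_image, not_exists, not_and]
    rintro I ⟨k, -, rfl⟩ k' - hk'
    have := (Prod.ext_iff.1 hk').1
    simp at this
    omega

/-! ### Dyadic systems, energies and the Carleson embedding -/

/-- A martingale-type family of vectors in a Hilbert space, modelled on `I ↦ 1_I`. -/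
structure DyadicSystem {E : Type*} [NormedAddCommGroup E] [InnerProductSpace ℂ E]
    (i : DyadicLabel → E) : Prop where
  split : ∀ I, i I = i (left I) + i (right I)
  orth : ∀ (j k k' : ℤ), k ≠ k' → inner ℂ (i (j, k)) (i (j, k')) = 0
  ne_zero : ∀ I, i I ≠ 0

namespace DyadicSystem

variable {E : Type*} [NormedAddCommGroup E] [InnerProductSpace ℂ E] {i : DyadicLabel → E}

theorem inner_left_right (hi : DyadicSystem i) (I : DyadicLabel) :
    inner ℂ (i (left I)) (i (right I)) = 0 :=
  hi.orth _ _ _ (by omega)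

theorem norm_sq_pos (hi : DyadicSystem i) (I : DyadicLabel) : 0 < ‖i I‖ ^ 2 := by
  have := norm_pos_iff.2 (hi.ne_zero I)
  positivity

theorem norm_sq_split (hi : DyadicSystem i) (I : DyadicLabel) :
    ‖i I‖ ^ 2 = ‖i (left I)‖ ^ 2 + ‖i (right I)‖ ^ 2 := by
  rw [hi.split I, @norm_add_sq ℂ, hi.inner_left_right I]
  simp

theorem norm_sub_sq (hi : DyadicSystem i) (I : DyadicLabel) :
    ‖i (right I) - i (left I)‖ ^ 2 = ‖i I‖ ^ 2 := by
  rw [hi.norm_sq_split I, ← norm_neg, neg_sub, @_root_.norm_sub_sq ℂ, hi.inner_left_right I]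
  simp

/-- Bessel's inequality for the normalized vectors of one generation. -/
theorem sum_norm_inner_sq_div_le (hi : DyadicSystem i) (f : E) (j : ℤ) (K : Finset ℤ) :
    ∑ k ∈ K, ‖inner ℂ (i (j, k)) f‖ ^ 2 / ‖i (j, k)‖ ^ 2 ≤ ‖f‖ ^ 2 := by
  let e : ℤ → E := fun k => ((‖i (j, k)‖ : ℂ)⁻¹) • i (j, k)
  have he : Orthonormal ℂ e := by
    constructor
    · intro k
      have := norm_pos_iff.2 (hi.ne_zero (j, k))
      simp only [e, norm_smul, norm_inv, Complex.norm_real, norm_norm]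
      field_simp
    · intro k k' hk
      simp only [e, inner_smul_left, inner_smul_right, hi.orth j k k' hk, mul_zero]
  refine le_of_eq_of_le (Finset.sum_congr rfl fun k _ => ?_) (he.sum_inner_products_le (s := K) f)
  simp only [e, inner_smul_left, norm_mul, mul_pow, map_inv₀, norm_inv, Complex.conj_ofReal,
    Complex.norm_real, norm_norm]
  ring

/-- The energy of the martingale difference of `f` on `I`. -/
noncomputable def energy (i : DyadicLabel → E) (f : E) (I : DyadicLabel) : ℝ :=
  ‖inner ℂ (i (left I)) f‖ ^ 2 / ‖i (left I)‖ ^ 2 +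
    ‖inner ℂ (i (right I)) f‖ ^ 2 / ‖i (right I)‖ ^ 2 - ‖inner ℂ (i I) f‖ ^ 2 / ‖i I‖ ^ 2

/-- Both sides are multiples of `‖a y - b x‖²`, with factors `4 / (a + b)²` and `1 / (a b)`; the
inequality is `4ab ≤ (a + b)²`. -/
theorem norm_sub_smul_sq_le {x y : ℂ} {a b : ℝ} (ha : 0 < a) (hb : 0 < b) :
    ‖y - x - ((b - a) / (a + b) : ℝ) * (x + y)‖ ^ 2 ≤
      (a + b) * (‖x‖ ^ 2 / a + ‖y‖ ^ 2 / b - ‖x + y‖ ^ 2 / (a + b)) := by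
  have h1 : y - x - ((b - a) / (a + b) : ℝ) * (x + y) = (2 / (a + b) : ℝ) * (a * y - b * x) := by
    have : (a : ℂ) + b ≠ 0 := by exact_mod_cast (by positivity : a + b ≠ 0)
    push_cast
    field_simp
    ring
  have h2 : ‖x‖ ^ 2 / a + ‖y‖ ^ 2 / b - ‖x + y‖ ^ 2 / (a + b) =
      ‖(a : ℂ) * y - b * x‖ ^ 2 / (a * b * (a + b)) := by
    simp only [Complex.sq_norm, Complex.normSq_apply, Complex.add_re, Complex.add_im,
      Complex.sub_re, Complex.sub_im, Complex.mul_re, Complex.mul_im, Complex.ofReal_re,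
      Complex.ofReal_im]
    field_simp
    ring
  rw [h1, h2, norm_mul, mul_pow, Complex.norm_real, Real.norm_eq_abs, sq_abs]
  set N := ‖(a : ℂ) * y - b * x‖ ^ 2
  have hN : 0 ≤ N := by positivity
  have h3 : (a + b) * (N / (a * b * (a + b))) = N / (a * b) := by field_simp
  have h4 : (2 / (a + b)) ^ 2 * N = N * 4 / (a + b) ^ 2 := by
    rw [div_pow]
    ring
  rw [h3, h4, div_le_div_iff₀ (by positivity) (by positivity)]
  nlinarith [mul_nonneg hN (sq_nonneg (a - b))]

theorem inner_split (hi : DyadicSystem i) (f : E) (I : DyadicLabel) :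
    inner ℂ (i I) f = inner ℂ (i (left I)) f + inner ℂ (i (right I)) f := by
  rw [hi.split I, inner_add_left]

/-- The difference of the coefficients on the two halves, up to its mean part, is controlled by
the energy. -/
theorem norm_inner_sub_mean_le (hi : DyadicSystem i) (f : E) (I : DyadicLabel) :
    ‖inner ℂ (i (right I) - i (left I)) f -
      ((‖i (right I)‖ ^ 2 - ‖i (left I)‖ ^ 2) / ‖i I‖ ^ 2 : ℝ) * inner ℂ (i I) f‖ ≤
      ‖i I‖ * √(energy i f I) := by
  refine le_of_sq_le_sq ?_ (by positivity)
  have key := norm_sub_smul_sq_le (x := inner ℂ (i (left I)) f) (y := inner ℂ (i (right I)) f)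
    (hi.norm_sq_pos (left I)) (hi.norm_sq_pos (right I))
  rw [← hi.norm_sq_split, ← hi.inner_split] at key
  rw [inner_sub_left, mul_pow, Real.sq_sqrt]
  · exact key
  · exact nonneg_of_mul_nonneg_right ((sq_nonneg _).trans key) (hi.norm_sq_pos I)

theorem energy_nonneg (hi : DyadicSystem i) (f : E) (I : DyadicLabel) : 0 ≤ energy i f I := by
  have key := norm_sub_smul_sq_le (x := inner ℂ (i (left I)) f) (y := inner ℂ (i (right I)) f)
    (hi.norm_sq_pos (left I)) (hi.norm_sq_pos (right I))
  rw [← hi.norm_sq_split, ← hi.inner_split] at key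
  exact nonneg_of_mul_nonneg_right ((sq_nonneg _).trans key) (hi.norm_sq_pos I)

/-- The energy is exactly the increment, under halving, of the squared norm of the projection of `f`
onto `i_I`, so it telescopes and Bessel bounds each generation. -/
theorem sum_energy_le (hi : DyadicSystem i) (f : E) (F : Finset DyadicLabel) :
    ∑ I ∈ F, energy i f I ≤ ‖f‖ ^ 2 := by
  refine sum_le_of_telescoping (ψ := fun I => ‖inner ℂ (i I) f‖ ^ 2 / ‖i I‖ ^ 2)
    (hi.energy_nonneg f) (fun I => by positivity) (fun I => ?_)
    (hi.sum_norm_inner_sq_div_le f) F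
  simp [energy]

/-- The Bellman function is `C X² / (C s + m)`, with coefficient `X`, mass `s` and Carleson mass
`m`. The quotient `X² / (C s + m)` is jointly convex, which handles halving. Dropping `c` from the
denominator gains at least `C X² c / (2 C s)²`, since `m ≤ C s`; this is the source of `4 * C`. -/
theorem carleson_step {X Y Z a b C c m p q : ℝ} (ha : 0 < a) (hb : 0 < b)
    (hX : 0 ≤ X) (hXYZ : X ≤ Y + Z) (hC : 0 < C) (hp : 0 ≤ p) (hq : 0 ≤ q)
    (hc : 0 ≤ c) (hm : m ≤ C * (a + b)) (hcm : c + p + q ≤ m) :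
    c * X ^ 2 / (a + b) ^ 2 / (4 * C) + C * X ^ 2 / (C * (a + b) + m) ≤
      C * Y ^ 2 / (C * a + p) + C * Z ^ 2 / (C * b + q) := by
  have hs : 0 < a + b := by positivity
  have hpa : 0 < C * a + p := by positivity
  have hqb : 0 < C * b + q := by positivity
  have hm0 : 0 ≤ m := by linarith
  have conv : (Y + Z) ^ 2 / (C * (a + b) + p + q) ≤ Y ^ 2 / (C * a + p) + Z ^ 2 / (C * b + q) := by
    rw [div_add_div _ _ hpa.ne' hqb.ne', div_le_div_iff₀ (by positivity) (by positivity)]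
    nlinarith [sq_nonneg (Y * (C * b + q) - Z * (C * a + p))]
  have h1 : X ^ 2 / (C * (a + b) + p + q) ≤ (Y + Z) ^ 2 / (C * (a + b) + p + q) := by gcongr
  have h2 : c * X ^ 2 / (a + b) ^ 2 / (4 * C) + C * X ^ 2 / (C * (a + b) + m) ≤
      C * (X ^ 2 / (C * (a + b) + p + q)) := by
    set S := C * (a + b) with hS
    have hS0 : 0 < S := by positivity
    have e1 : C * (X ^ 2 / (S + p + q)) - C * X ^ 2 / (S + m) =
        C * X ^ 2 * (m - p - q) / ((S + p + q) * (S + m)) := by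
      field_simp
      ring
    have e2 : c * X ^ 2 / (a + b) ^ 2 / (4 * C) = C * X ^ 2 * c / ((2 * S) * (2 * S)) := by
      rw [hS]
      field_simp
      ring
    have hmpq : 0 ≤ m - p - q := by linarith
    have e3 : C * X ^ 2 * c / ((2 * S) * (2 * S)) ≤
        C * X ^ 2 * (m - p - q) / ((S + p + q) * (S + m)) := by
      have : 0 ≤ C * X ^ 2 * (m - p - q) := by positivity
      gcongr <;> linarith
    linarith
  calc _ ≤ _ := h2
    _ ≤ C * (Y ^ 2 / (C * a + p) + Z ^ 2 / (C * b + q)) := by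
      gcongr; exact h1.trans conv
    _ = _ := by ring

/-- The dyadic Carleson embedding theorem. -/
theorem carleson_embedding (hi : DyadicSystem i) {c m : DyadicLabel → ℝ} {C : ℝ} (hC : 0 ≤ C)
    (hc : ∀ I, 0 ≤ c I) (hm0 : ∀ I, 0 ≤ m I) (hm : ∀ I, m I ≤ C * ‖i I‖ ^ 2)
    (hcm : ∀ I, c I + m (left I) + m (right I) ≤ m I) (f : E) (F : Finset DyadicLabel) :
    ∑ I ∈ F, c I * ‖inner ℂ (i I) f‖ ^ 2 / (‖i I‖ ^ 2) ^ 2 ≤ 4 * C * ‖f‖ ^ 2 := by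
  -- The Bellman function degenerates at `C = 0`, but then `m`, and hence every `c I`, vanishes.
  rcases hC.eq_or_lt with rfl | hC
  · have : ∀ I, c I = 0 := fun I => by
      linarith [hc I, hm I, hcm I, hm0 (left I), hm0 (right I)]
    simp [this]
  have key := sum_le_of_telescoping (F := F) (N := ‖f‖ ^ 2)
    (g := fun I => c I * ‖inner ℂ (i I) f‖ ^ 2 / (‖i I‖ ^ 2) ^ 2 / (4 * C))
    (ψ := fun I => C * ‖inner ℂ (i I) f‖ ^ 2 / (C * ‖i I‖ ^ 2 + m I))
    (fun I => by have := hc I; positivity) (fun I => by have := hm0 I; positivity) ?_ ?_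
  · rw [← Finset.sum_div, div_le_iff₀ (by positivity)] at key
    linarith
  · intro I
    have hmI := hm I
    simp only [hi.norm_sq_split I] at hmI ⊢
    refine carleson_step (hi.norm_sq_pos _) (hi.norm_sq_pos _) (norm_nonneg _) ?_ hC
      (hm0 _) (hm0 _) (hc I) hmI (hcm I)
    rw [hi.inner_split]
    exact norm_add_le _ _
  · intro j K
    refine le_trans (Finset.sum_le_sum fun k _ => ?_) (hi.sum_norm_inner_sq_div_le f j K)
    have := hi.norm_sq_pos (j, k)
    have := hm0 (j, k)
    rw [div_le_div_iff₀ (by positivity) (by positivity)]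
    nlinarith [sq_nonneg ‖inner ℂ (i (j, k)) f‖, mul_nonneg (sq_nonneg ‖inner ℂ (i (j, k)) f‖) this]

end DyadicSystem

/-! ### Upper bounds for the bilinear form of two systems -/

theorem sum_mul_le_of_sum_sq_le {ι : Type*} {F : Finset ι} {f g : ι → ℝ} {X Y : ℝ} (hX : 0 ≤ X)
    (hY : 0 ≤ Y) (hf : ∑ I ∈ F, f I ^ 2 ≤ X ^ 2) (hg : ∑ I ∈ F, g I ^ 2 ≤ Y ^ 2) :
    ∑ I ∈ F, f I * g I ≤ X * Y := by
  refine (Real.sum_mul_le_sqrt_mul_sqrt F f g).trans ?_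
  gcongr
  · exact Real.sqrt_le_iff.2 ⟨hX, hf⟩
  · exact Real.sqrt_le_iff.2 ⟨hY, hg⟩

section TwoSystems

variable {E H : Type*} [NormedAddCommGroup E] [InnerProductSpace ℂ E] [NormedAddCommGroup H]
  [InnerProductSpace ℂ H]

/-- The difference of the masses of the two halves of `I`. -/
noncomputable def massDiff (i : DyadicLabel → E) (I : DyadicLabel) : ℝ :=
  ‖i (right I)‖ ^ 2 - ‖i (left I)‖ ^ 2

/-- The contribution of the mean to the coefficient `⟨i_{I₊} - i_{I₋}, f⟩`. -/
noncomputable def meanPart (i : DyadicLabel → E) (f : E) (I : DyadicLabel) : ℝ :=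
  |massDiff i I| * ‖inner ℂ (i I) f‖ / ‖i I‖ ^ 2

/-- The bound for the oscillating part of the coefficient `⟨i_{I₊} - i_{I₋}, f⟩`. -/
noncomputable def oscPart (i : DyadicLabel → E) (f : E) (I : DyadicLabel) : ℝ :=
  ‖i I‖ * √(DyadicSystem.energy i f I)

/-- The multiplier of the positive operator attached to two dyadic systems. -/
noncomputable def posCoeff (s : DyadicLabel → ℝ) (i : DyadicLabel → E) (l : DyadicLabel → H)
    (I : DyadicLabel) : ℝ :=
  4 * s I * |massDiff i I| * |massDiff l I| / (‖i I‖ ^ 2 * ‖l I‖ ^ 2)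

theorem meanPart_nonneg (i : DyadicLabel → E) (f : E) (I : DyadicLabel) : 0 ≤ meanPart i f I := by
  unfold meanPart; positivity

theorem oscPart_nonneg (i : DyadicLabel → E) (f : E) (I : DyadicLabel) : 0 ≤ oscPart i f I := by
  unfold oscPart; positivity

/-- The form of the positive operator is the mean-mean interaction. The `4` offsets the two halves
in the mass differences `|I| Δ_I / 2`. -/
theorem posCoeff_mul_eq (s : DyadicLabel → ℝ) (i : DyadicLabel → E) (l : DyadicLabel → H)
    (f : E) (φ : H) (I : DyadicLabel) :
    posCoeff s i l I * ‖inner ℂ (i I) f‖ * ‖inner ℂ (l I) φ‖ =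
      4 * (s I * meanPart i f I * meanPart l φ I) := by
  unfold posCoeff meanPart
  ring

namespace DyadicSystem

variable {i : DyadicLabel → E} {l : DyadicLabel → H} {s : DyadicLabel → ℝ}

theorem norm_mean_term (i : DyadicLabel → E) (f : E) (I : DyadicLabel) :
    ‖((‖i (right I)‖ ^ 2 - ‖i (left I)‖ ^ 2) / ‖i I‖ ^ 2 : ℝ) * inner ℂ (i I) f‖ =
      meanPart i f I := by
  rw [norm_mul, Complex.norm_real, Real.norm_eq_abs, abs_div, abs_of_nonneg (sq_nonneg ‖i I‖)]
  unfold meanPart massDiff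
  ring

theorem norm_inner_sub_le (hi : DyadicSystem i) (f : E) (I : DyadicLabel) :
    ‖inner ℂ (i (right I) - i (left I)) f‖ ≤ oscPart i f I + meanPart i f I := by
  rw [← norm_mean_term]
  refine le_trans ?_ (add_le_add_left (hi.norm_inner_sub_mean_le f I) _)
  exact norm_le_norm_sub_add _ _

theorem meanPart_le (hi : DyadicSystem i) (f : E) (I : DyadicLabel) :
    meanPart i f I ≤ ‖inner ℂ (i (right I) - i (left I)) f‖ + oscPart i f I := by
  rw [← norm_mean_term]
  refine le_trans ?_ (add_le_add_right (hi.norm_inner_sub_mean_le f I) _)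
  rw [norm_sub_rev]
  exact norm_le_norm_add_norm_sub' _ _

theorem sum_sqrt_energy_sq_le (hi : DyadicSystem i) (f : E) (F : Finset DyadicLabel) :
    ∑ I ∈ F, √(energy i f I) ^ 2 ≤ ‖f‖ ^ 2 := by
  simpa only [Real.sq_sqrt (hi.energy_nonneg f _)] using hi.sum_energy_le f F

/-- The contribution of the two oscillating parts. -/
theorem sum_osc_mul_osc_le (hi : DyadicSystem i) (hl : DyadicSystem l) {C : ℝ} (hC : 0 ≤ C)
    (h : ∀ I, s I ^ 2 * ‖i I‖ ^ 2 * ‖l I‖ ^ 2 ≤ C) (f : E) (φ : H) (F : Finset DyadicLabel) :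
    ∑ I ∈ F, s I * oscPart i f I * oscPart l φ I ≤ √C * ‖f‖ * ‖φ‖ := by
  have := sum_mul_le_of_sum_sq_le (F := F)
    (f := fun I => s I * ‖i I‖ * ‖l I‖ * √(energy i f I)) (g := fun I => √(energy l φ I))
    (X := √C * ‖f‖) (Y := ‖φ‖) (by positivity) (by positivity) ?_ (hl.sum_sqrt_energy_sq_le φ F)
  · refine le_of_eq_of_le (Finset.sum_congr rfl fun I _ => ?_) this
    unfold oscPart
    ring
  · rw [mul_pow, Real.sq_sqrt hC]
    refine le_trans ?_ (mul_le_mul_of_nonneg_left (hi.sum_sqrt_energy_sq_le f F) hC)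
    rw [Finset.mul_sum]
    refine Finset.sum_le_sum fun I _ => ?_
    rw [mul_pow, mul_pow, mul_pow]
    exact mul_le_mul_of_nonneg_right (h I) (sq_nonneg _)

/-- The mean part against the oscillating part, by the Carleson embedding theorem. -/
theorem sum_mean_mul_osc_le (hi : DyadicSystem i) (hl : DyadicSystem l) {C : ℝ} (hC : 0 ≤ C)
    {m : DyadicLabel → ℝ} (hm0 : ∀ I, 0 ≤ m I) (hm : ∀ I, m I ≤ C * ‖i I‖ ^ 2)
    (hcm : ∀ I, 4 * s I ^ 2 * massDiff i I ^ 2 * ‖l I‖ ^ 2 + m (left I) + m (right I) ≤ m I)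
    (f : E) (φ : H) (F : Finset DyadicLabel) :
    ∑ I ∈ F, s I * meanPart i f I * oscPart l φ I ≤ √C * ‖f‖ * ‖φ‖ := by
  have := sum_mul_le_of_sum_sq_le (F := F)
    (f := fun I => s I * ‖l I‖ * meanPart i f I) (g := fun I => √(energy l φ I))
    (X := √C * ‖f‖) (Y := ‖φ‖) (by positivity) (by positivity) ?_ (hl.sum_sqrt_energy_sq_le φ F)
  · refine le_of_eq_of_le (Finset.sum_congr rfl fun I _ => ?_) this
    unfold oscPart
    ring
  · rw [mul_pow, Real.sq_sqrt hC]
    have := hi.carleson_embedding hC (fun I => by positivity) hm0 hm hcm f F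
    -- The factor `4⁻¹` cancels the `4` lost in the Carleson embedding, leaving exactly `√C`.
    have e : ∀ I, (s I * ‖l I‖ * meanPart i f I) ^ 2 = 4⁻¹ * (4 * s I ^ 2 * massDiff i I ^ 2 *
        ‖l I‖ ^ 2 * ‖inner ℂ (i I) f‖ ^ 2 / (‖i I‖ ^ 2) ^ 2) := by
      intro I
      simp only [meanPart, mul_pow, div_pow, sq_abs]
      ring
    simp only [e]
    rw [← Finset.mul_sum]
    linarith

/-- The bilinear upper bound from the joint condition, the two Carleson conditions and the bound
for the positive operator. -/
theorem sum_coeff_mul_coeff_le (hi : DyadicSystem i) (hl : DyadicSystem l) (hs : ∀ I, 0 ≤ s I)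
    {C₁ C₂ C₃ C₄ : ℝ} (hC₁ : 0 ≤ C₁) (hC₂ : 0 ≤ C₂) (hC₃ : 0 ≤ C₃)
    (h : ∀ I, s I ^ 2 * ‖i I‖ ^ 2 * ‖l I‖ ^ 2 ≤ C₁)
    {m : DyadicLabel → ℝ} (hm0 : ∀ I, 0 ≤ m I) (hm : ∀ I, m I ≤ C₂ * ‖i I‖ ^ 2)
    (hcm : ∀ I, 4 * s I ^ 2 * massDiff i I ^ 2 * ‖l I‖ ^ 2 + m (left I) + m (right I) ≤ m I)
    {n : DyadicLabel → ℝ} (hn0 : ∀ I, 0 ≤ n I) (hn : ∀ I, n I ≤ C₃ * ‖l I‖ ^ 2)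
    (hcn : ∀ I, 4 * s I ^ 2 * massDiff l I ^ 2 * ‖i I‖ ^ 2 + n (left I) + n (right I) ≤ n I)
    (f : E) (φ : H) (F : Finset DyadicLabel)
    (hP : ∑ I ∈ F, posCoeff s i l I * ‖inner ℂ (i I) f‖ * ‖inner ℂ (l I) φ‖ ≤ C₄ * ‖f‖ * ‖φ‖) :
    ∑ I ∈ F, s I * ‖inner ℂ (i (right I) - i (left I)) f‖ *
      ‖inner ℂ (l (right I) - l (left I)) φ‖ ≤ (√C₁ + √C₂ + √C₃ + C₄) * (‖f‖ * ‖φ‖) := by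
  have h1 := hi.sum_osc_mul_osc_le hl hC₁ h f φ F
  have h2 := hi.sum_mean_mul_osc_le hl hC₂ hm0 hm hcm f φ F
  have h3 := hl.sum_mean_mul_osc_le hi hC₃ hn0 hn hcn φ f F
  simp only [posCoeff_mul_eq] at hP
  rw [← Finset.mul_sum] at hP
  -- `hP` bounds four times the mean-mean sum; nonnegativity lets the extra factor be discarded.
  have hpos : 0 ≤ ∑ I ∈ F, s I * meanPart i f I * meanPart l φ I :=
    Finset.sum_nonneg fun I _ =>
      mul_nonneg (mul_nonneg (hs I) (meanPart_nonneg i f I)) (meanPart_nonneg l φ I)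
  have hle : ∑ I ∈ F, s I * ‖inner ℂ (i (right I) - i (left I)) f‖ *
      ‖inner ℂ (l (right I) - l (left I)) φ‖ ≤
      ∑ I ∈ F, (s I * oscPart i f I * oscPart l φ I + s I * meanPart i f I * oscPart l φ I +
        s I * meanPart l φ I * oscPart i f I + s I * meanPart i f I * meanPart l φ I) := by
    refine Finset.sum_le_sum fun I _ => ?_
    calc _ ≤ s I * (oscPart i f I + meanPart i f I) * (oscPart l φ I + meanPart l φ I) := by
          have := hs I
          have := oscPart_nonneg i f I
          have := meanPart_nonneg i f I
          gcongr
          · exact hi.norm_inner_sub_le f I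
          · exact hl.norm_inner_sub_le φ I
      _ = _ := by ring
  simp only [Finset.sum_add_distrib] at hle
  linarith

end DyadicSystem

/-! ### Consequences of uniform bounds over signs -/

/-- The `I`-th term of the (unsigned) Haar multiplier of two dyadic systems. -/
noncomputable def haarRankOne (s : DyadicLabel → ℝ) (i : DyadicLabel → E) (l : DyadicLabel → H)
    (I : DyadicLabel) (f : E) : H :=
  ((s I : ℂ) * inner ℂ (i (right I) - i (left I)) f) • (l (right I) - l (left I))

/-- All signed finite partial sums of the Haar multipliers are bounded by `M`. -/
def SignedBound (s : DyadicLabel → ℝ) (i : DyadicLabel → E) (l : DyadicLabel → H) (M : ℝ) : Prop :=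
  ∀ (F : Finset DyadicLabel) (e : DyadicLabel → ℤˣ) (f : E),
    ‖∑ J ∈ F, ((e J : ℤ) : ℂ) • haarRankOne s i l J f‖ ≤ M * ‖f‖

/-- The adjoint of a Haar term is the Haar term with the two systems interchanged. -/
theorem inner_haarRankOne (s : DyadicLabel → ℝ) (i : DyadicLabel → E) (l : DyadicLabel → H)
    (I : DyadicLabel) (f : E) (φ : H) :
    inner ℂ φ (haarRankOne s i l I f) = inner ℂ (haarRankOne s l i I φ) f := by
  unfold haarRankOne
  rw [inner_smul_right, inner_smul_left, map_mul, Complex.conj_ofReal, inner_conj_symm]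
  ring

namespace SignedBound

variable {i : DyadicLabel → E} {l : DyadicLabel → H} {s : DyadicLabel → ℝ} {M : ℝ}

theorem dual (h : SignedBound s i l M) (hM : 0 ≤ M) : SignedBound s l i M := by
  intro F e φ
  set g := ∑ J ∈ F, ((e J : ℤ) : ℂ) • haarRankOne s l i J φ with hg
  have h1 : inner ℂ g g = inner ℂ φ (∑ J ∈ F, ((e J : ℤ) : ℂ) • haarRankOne s i l J g) := by
    conv_lhs => rw [hg]
    rw [sum_inner, inner_sum]
    refine Finset.sum_congr rfl fun J _ => ?_
    rw [inner_smul_left, inner_smul_right, inner_haarRankOne, ← hg]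
    simp
  have h2 : ‖g‖ ^ 2 ≤ M * ‖φ‖ * ‖g‖ := by
    have h3 : ‖inner ℂ g g‖ = ‖g‖ ^ 2 := by
      rw [inner_self_eq_norm_sq_to_K]; simp
    rw [← h3, h1]
    refine (norm_inner_le_norm _ _).trans ?_
    have := mul_le_mul_of_nonneg_left (h F e g) (norm_nonneg φ)
    linarith
  rcases (norm_nonneg g).eq_or_lt with h0 | h0
  · rw [← h0]; positivity
  · nlinarith

/-- For suitable signs the squared norm of the sum dominates the sum of squared norms, and `‖l_{I₊}
- l_{I₋}‖ = ‖l_I‖` by orthogonality of the halves. -/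
theorem sum_sq_le (h : SignedBound s i l M) (hl : DyadicSystem l)
    (F : Finset DyadicLabel) (f : E) :
    ∑ I ∈ F, s I ^ 2 * ‖inner ℂ (i (right I) - i (left I)) f‖ ^ 2 * ‖l I‖ ^ 2 ≤
      (M * ‖f‖) ^ 2 := by
  obtain ⟨e, he⟩ := exists_signs_sum_sq_le (fun J => haarRankOne s i l J f) F
  have : ‖∑ J ∈ F, ((e J : ℤ) : ℂ) • haarRankOne s i l J f‖ ^ 2 ≤ (M * ‖f‖) ^ 2 := by
    gcongr; exact h F e f
  refine le_trans (le_of_eq (Finset.sum_congr rfl fun J _ => ?_)) (he.trans this)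
  rw [haarRankOne, norm_smul, mul_pow, hl.norm_sub_sq, norm_mul, mul_pow, Complex.norm_real,
    Real.norm_eq_abs, sq_abs]

theorem exists_sign_mul_eq_abs (x : ℝ) : ∃ e : ℤˣ, ((e : ℤ) : ℝ) * x = |x| := by
  rcases le_total 0 x with h | h
  · exact ⟨1, by simp [abs_of_nonneg h]⟩
  · exact ⟨-1, by simp [abs_of_nonpos h]⟩

theorem sum_abs_re_le (h : SignedBound s i l M) (F : Finset DyadicLabel) (f : E) (φ : H) :
    ∑ I ∈ F, |(inner ℂ φ (haarRankOne s i l I f)).re| ≤ M * ‖f‖ * ‖φ‖ := by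
  choose e he using fun I => exists_sign_mul_eq_abs (inner ℂ φ (haarRankOne s i l I f)).re
  have h1 : ∑ I ∈ F, |(inner ℂ φ (haarRankOne s i l I f)).re| =
      (inner ℂ φ (∑ J ∈ F, ((e J : ℤ) : ℂ) • haarRankOne s i l J f)).re := by
    rw [inner_sum, Complex.re_sum]
    refine Finset.sum_congr rfl fun J _ => ?_
    rw [← he, inner_smul_right, Complex.mul_re]
    simp
  rw [h1]
  refine (Complex.re_le_norm _).trans ((norm_inner_le_norm _ _).trans ?_)
  have := mul_le_mul_of_nonneg_left (h F e f) (norm_nonneg φ)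
  linarith

/-- Real signs align only real parts; imaginary parts are reached by replacing `φ` with `Complex.I •
φ`, hence the factor `2`. -/
theorem sum_coeff_mul_coeff_le (h : SignedBound s i l M) (hs : ∀ I, 0 ≤ s I)
    (F : Finset DyadicLabel) (f : E) (φ : H) :
    ∑ I ∈ F, s I * ‖inner ℂ (i (right I) - i (left I)) f‖ *
      ‖inner ℂ (l (right I) - l (left I)) φ‖ ≤ 2 * M * (‖f‖ * ‖φ‖) := by
  have h1 := h.sum_abs_re_le F f φ
  have h2 := h.sum_abs_re_le F f (Complex.I • φ)
  have e : ‖Complex.I • φ‖ = ‖φ‖ := by rw [norm_smul]; simp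
  rw [e] at h2
  have h3 : ∀ I, s I * ‖inner ℂ (i (right I) - i (left I)) f‖ *
      ‖inner ℂ (l (right I) - l (left I)) φ‖ ≤
      |(inner ℂ φ (haarRankOne s i l I f)).re| +
        |(inner ℂ (Complex.I • φ) (haarRankOne s i l I f)).re| := by
    intro I
    have h4 : s I * ‖inner ℂ (i (right I) - i (left I)) f‖ *
      ‖inner ℂ (l (right I) - l (left I)) φ‖ = ‖inner ℂ φ (haarRankOne s i l I f)‖ := by
      rw [haarRankOne, inner_smul_right, norm_mul, norm_mul, Complex.norm_real,
        Real.norm_of_nonneg (hs I), norm_inner_symm φ]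
    rw [h4, inner_smul_left]
    refine (Complex.norm_le_abs_re_add_abs_im _).trans (le_of_eq ?_)
    simp
  refine (Finset.sum_le_sum fun I _ => h3 I).trans ?_
  rw [Finset.sum_add_distrib]
  linarith

/-- The square function bound is tested on `f = i_{I₊} - i_{I₋}`, keeping only the term `I`. -/
theorem sq_mul_norm_sq_mul_norm_sq_le (h : SignedBound s i l M) (hi : DyadicSystem i)
    (hl : DyadicSystem l) (I : DyadicLabel) : s I ^ 2 * ‖i I‖ ^ 2 * ‖l I‖ ^ 2 ≤ M ^ 2 := by
  have := h.sum_sq_le hl {I} (i (right I) - i (left I))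
  rw [Finset.sum_singleton, mul_pow, hi.norm_sub_sq, inner_self_eq_norm_sq_to_K] at this
  simp only [norm_pow, Complex.coe_algebraMap, Complex.norm_real, norm_norm, hi.norm_sub_sq] at this
  have hp := hi.norm_sq_pos I
  refine le_of_mul_le_mul_right ?_ hp
  linarith

theorem sum_coeff_mul_osc_le (h : SignedBound s i l M) (hM : 0 ≤ M) (hl : DyadicSystem l)
    (F : Finset DyadicLabel) (f : E) (φ : H) :
    ∑ I ∈ F, s I * ‖inner ℂ (i (right I) - i (left I)) f‖ * oscPart l φ I ≤ M * ‖f‖ * ‖φ‖ := by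
  have := sum_mul_le_of_sum_sq_le (F := F)
    (f := fun I => s I * ‖inner ℂ (i (right I) - i (left I)) f‖ * ‖l I‖)
    (g := fun I => √(DyadicSystem.energy l φ I))
    (X := M * ‖f‖) (Y := ‖φ‖) (by positivity) (by positivity) ?_ (hl.sum_sqrt_energy_sq_le φ F)
  · refine le_of_eq_of_le (Finset.sum_congr rfl fun I _ => ?_) this
    unfold oscPart
    ring
  · simpa only [mul_pow] using h.sum_sq_le hl F f

/-- The signed bounds control the bilinear form of the positive operator. -/
theorem sum_posCoeff_le (h : SignedBound s i l M) (hM : 0 ≤ M) (hs : ∀ I, 0 ≤ s I)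
    (hi : DyadicSystem i) (hl : DyadicSystem l) (F : Finset DyadicLabel) (f : E) (φ : H) :
    ∑ I ∈ F, posCoeff s i l I * ‖inner ℂ (i I) f‖ * ‖inner ℂ (l I) φ‖ ≤
      20 * M * (‖f‖ * ‖φ‖) := by
  simp only [posCoeff_mul_eq]
  rw [← Finset.mul_sum]
  -- Each mean part is at most a full coefficient plus an oscillating part. The four resulting sums
  -- cost `2M`, `M`, `M`, `M`, and the factor `4` in `posCoeff` gives `20M`.
  have h1 := h.sum_coeff_mul_coeff_le hs F f φ
  have h2 := h.sum_coeff_mul_osc_le hM hl F f φ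
  have h3 := (h.dual hM).sum_coeff_mul_osc_le hM hi F φ f
  have h4 := hi.sum_osc_mul_osc_le hl (sq_nonneg M)
    (h.sq_mul_norm_sq_mul_norm_sq_le hi hl) f φ F
  rw [Real.sqrt_sq hM] at h4
  have hle : ∑ I ∈ F, s I * meanPart i f I * meanPart l φ I ≤
      ∑ I ∈ F, (s I * ‖inner ℂ (i (right I) - i (left I)) f‖ *
          ‖inner ℂ (l (right I) - l (left I)) φ‖ +
        s I * ‖inner ℂ (i (right I) - i (left I)) f‖ * oscPart l φ I +
        s I * ‖inner ℂ (l (right I) - l (left I)) φ‖ * oscPart i f I +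
        s I * oscPart i f I * oscPart l φ I) := by
    refine Finset.sum_le_sum fun I _ => ?_
    calc _ ≤ s I * (‖inner ℂ (i (right I) - i (left I)) f‖ + oscPart i f I) *
          (‖inner ℂ (l (right I) - l (left I)) φ‖ + oscPart l φ I) := by
          have := hs I
          have := oscPart_nonneg i f I
          have := meanPart_nonneg l φ I
          gcongr
          · exact hi.meanPart_le f I
          · exact hl.meanPart_le φ I
      _ = _ := by ring
  simp only [Finset.sum_add_distrib] at hle
  linarith

end SignedBound

/-- A bilinear bound for a finite sum of rank one operators gives a norm bound. -/
theorem norm_sum_smul_le {c : DyadicLabel → ℂ} {l : DyadicLabel → H} {F : Finset DyadicLabel}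
    {X : ℝ} (hX : 0 ≤ X) (h : ∀ φ : H, ∑ I ∈ F, ‖c I‖ * ‖inner ℂ (l I) φ‖ ≤ X * ‖φ‖) :
    ‖∑ I ∈ F, c I • l I‖ ≤ X := by
  set φ := ∑ I ∈ F, c I • l I with hφ
  have h1 : ‖φ‖ ^ 2 ≤ X * ‖φ‖ := by
    have h3 : ‖inner ℂ φ φ‖ = ‖φ‖ ^ 2 := by
      rw [inner_self_eq_norm_sq_to_K]; simp
    rw [← h3]
    refine le_trans ?_ (h φ)
    conv_lhs => rw [hφ]
    rw [← hφ, sum_inner]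
    refine (norm_sum_le _ _).trans (Finset.sum_le_sum fun I _ => ?_)
    rw [inner_smul_left, norm_mul]
    simp
  rcases (norm_nonneg φ).eq_or_lt with h0 | h0
  · rwa [← h0]
  · nlinarith

end TwoSystems

theorem posCoeff_nonneg {E H : Type*} [NormedAddCommGroup E] [NormedAddCommGroup H]
    {s : DyadicLabel → ℝ} (hs : ∀ I, 0 ≤ s I) (i : DyadicLabel → E)
    (l : DyadicLabel → H) (I : DyadicLabel) : 0 ≤ posCoeff s i l I := by
  have := hs I
  unfold posCoeff; positivity

/-! ### Geometry of dyadic intervals -/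

theorem len_pos (I : DyadicLabel) : 0 < len I := zpow_pos (by norm_num) _

theorem len_left (I : DyadicLabel) : len (left I) = len I / 2 := by
  simp only [len, left]
  rw [neg_add, zpow_add₀ (by norm_num)]
  norm_num [div_eq_mul_inv]

theorem len_right (I : DyadicLabel) : len (right I) = len I / 2 := len_left I

theorem ivl_eq (I : DyadicLabel) : ivl I = Ico (len I * I.2) (len I * (I.2 + 1)) := rfl

theorem measurableSet_ivl (I : DyadicLabel) : MeasurableSet (ivl I) := measurableSet_Ico

theorem volume_ivl (I : DyadicLabel) : volume (ivl I) = ENNReal.ofReal (len I) := by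
  rw [ivl_eq, Real.volume_Ico]
  congr 1
  ring

theorem ivl_left (I : DyadicLabel) : ivl (left I) = Ico (len I * I.2) (len I * (I.2 + 1 / 2)) := by
  rw [ivl_eq, len_left]
  simp only [left]
  push_cast
  congr 1 <;> ring

theorem ivl_right (I : DyadicLabel) :
    ivl (right I) = Ico (len I * (I.2 + 1 / 2)) (len I * (I.2 + 1)) := by
  rw [ivl_eq, len_right]
  simp only [right]
  push_cast
  congr 1 <;> ring

theorem ivl_left_union_right (I : DyadicLabel) : ivl (left I) ∪ ivl (right I) = ivl I := by
  have := len_pos I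
  rw [ivl_left, ivl_right, ivl_eq, Ico_union_Ico_eq_Ico]
  · gcongr; norm_num
  · gcongr; norm_num

theorem disjoint_ivl_left_right (I : DyadicLabel) : Disjoint (ivl (left I)) (ivl (right I)) := by
  rw [ivl_left, ivl_right]
  exact Ico_disjoint_Ico_same

theorem ivl_left_subset (I : DyadicLabel) : ivl (left I) ⊆ ivl I :=
  (ivl_left_union_right I).subset.trans' subset_union_left

theorem ivl_right_subset (I : DyadicLabel) : ivl (right I) ⊆ ivl I :=
  (ivl_left_union_right I).subset.trans' subset_union_right

theorem ivl_nonempty (I : DyadicLabel) : (ivl I).Nonempty := by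
  have := len_pos I
  rw [ivl_eq, nonempty_Ico]
  nlinarith

theorem ivl_subset_Icc (I : DyadicLabel) : ivl I ⊆ Icc (len I * I.2) (len I * (I.2 + 1)) :=
  Ico_subset_Icc_self

theorem disjoint_ivl_of_ne {j k k' : ℤ} (h : k ≠ k') : Disjoint (ivl (j, k)) (ivl (j, k')) := by
  wlog hlt : k < k' generalizing k k'
  · exact (this h.symm (lt_of_le_of_ne (not_lt.1 hlt) h.symm)).symm
  have h1 : (k : ℝ) + 1 ≤ k' := by exact_mod_cast hlt
  have h2 := len_pos (j, k)
  have h3 : len (j, k) = len (j, k') := rfl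
  rw [ivl_eq, ivl_eq, ← h3, Set.disjoint_left]
  rintro x ⟨-, hx⟩ ⟨hx', -⟩
  have : len (j, k) * ((k : ℝ) + 1) ≤ len (j, k) * k' := by gcongr
  dsimp only at hx hx'
  linarith

/-! ### Weighted spaces and truncated test functions -/

namespace IsWeight

variable {m : ℝ → ℝ}

theorem aemeasurable (hm : IsWeight m) : AEMeasurable m volume :=
  hm.locallyIntegrable.aestronglyMeasurable.aemeasurable

theorem integrableOn_ivl (hm : IsWeight m) (I : DyadicLabel) : IntegrableOn m (ivl I) volume :=
  (hm.locallyIntegrable.integrableOn_isCompact isCompact_Icc).mono_set (ivl_subset_Icc I)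

theorem volume_ac (hm : IsWeight m) : (volume : Measure ℝ) ≪ weightMeasure m := by
  refine withDensity_absolutelyContinuous' hm.aemeasurable.ennreal_ofReal ?_
  filter_upwards [hm.ae_pos] with x hx
  simpa using hx

theorem ac_volume (m : ℝ → ℝ) : weightMeasure m ≪ (volume : Measure ℝ) :=
  withDensity_absolutelyContinuous _ _

theorem integral_weightMeasure (hm : IsWeight m) (F : ℝ → ℂ) :
    ∫ x, F x ∂(weightMeasure m) = ∫ x, (m x : ℂ) * F x := by
  rw [weightMeasure, integral_withDensity_eq_integral_toReal_smul₀
    hm.aemeasurable.ennreal_ofReal (by simp)]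
  refine integral_congr_ae ?_
  filter_upwards [hm.ae_pos] with x hx
  rw [ENNReal.toReal_ofReal hx.le, Complex.real_smul]

theorem integrable_weightMeasure (hm : IsWeight m) {E : Type*} [NormedAddCommGroup E]
    [NormedSpace ℝ E] {F : ℝ → E} :
    Integrable F (weightMeasure m) ↔ Integrable (fun x => m x • F x) volume := by
  rw [weightMeasure, integrable_withDensity_iff_integrable_smul₀'
    hm.aemeasurable.ennreal_ofReal (by simp)]
  refine integrable_congr ?_
  filter_upwards [hm.ae_pos] with x hx
  rw [ENNReal.toReal_ofReal hx.le]

end IsWeight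

theorem integral_ivl_pos {g : ℝ → ℝ} (hg : ∀ᵐ x, 0 < g x) {I : DyadicLabel}
    (hint : IntegrableOn g (ivl I)) : 0 < ∫ x in ivl I, g x := by
  rw [setIntegral_pos_iff_support_of_nonneg_ae
    (ae_restrict_of_ae (hg.mono fun x hx => hx.le)) hint]
  have h : (Function.support g ∩ ivl I : Set ℝ) =ᵐ[volume] ivl I := by
    filter_upwards [hg] with x hx
    have : x ∈ Function.support g := hx.ne'
    exact propext ⟨fun h => h.2, fun h => ⟨this, h⟩⟩
  rw [measure_congr h, volume_ivl]
  simpa using len_pos I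

/-- A weight `m` and a positive function `g` that is locally in `L²(m)`. -/
structure IsTestPair (m g : ℝ → ℝ) : Prop where
  weight : IsWeight m
  aemeasurable : AEMeasurable g volume
  ae_pos : ∀ᵐ x, 0 < g x
  integrableOn : ∀ I, IntegrableOn (fun x => m x * g x ^ 2) (ivl I) volume

/-- The function `1_I g`. -/
noncomputable def bump (g : ℝ → ℝ) (I : DyadicLabel) : ℝ → ℂ :=
  (ivl I).indicator fun x => (g x : ℂ)

theorem memLp_two_weightMeasure_iff {m : ℝ → ℝ} (hm : IsWeight m) {F : ℝ → ℂ}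
    (hF : AEStronglyMeasurable F volume) :
    MemLp F 2 (weightMeasure m) ↔ Integrable (fun x => m x * ‖F x‖ ^ 2) volume := by
  rw [memLp_two_iff_integrable_sq_norm (hF.mono_ac (IsWeight.ac_volume m)),
    hm.integrable_weightMeasure]
  rfl

namespace IsTestPair

variable {m g : ℝ → ℝ}

theorem aestronglyMeasurable_bump (h : IsTestPair m g) (I : DyadicLabel) :
    AEStronglyMeasurable (bump g I) volume :=
  (Complex.measurable_ofReal.comp_aemeasurable h.aemeasurable).aestronglyMeasurable.indicator
    (measurableSet_ivl I)

theorem memLp_bump (h : IsTestPair m g) (I : DyadicLabel) :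
    MemLp (bump g I) 2 (weightMeasure m) := by
  rw [memLp_two_weightMeasure_iff h.weight (h.aestronglyMeasurable_bump I)]
  refine ((integrable_indicator_iff (measurableSet_ivl I)).2 (h.integrableOn I)).congr
    (Filter.Eventually.of_forall fun x => ?_)
  by_cases hx : x ∈ ivl I <;> simp [bump, hx]

/-- The class of `1_I g` in `L²(m)`. -/
noncomputable def testVec (h : IsTestPair m g) (I : DyadicLabel) : L2 m := (h.memLp_bump I).toLp

theorem coeFn_testVec (h : IsTestPair m g) (I : DyadicLabel) :
    h.testVec I =ᵐ[volume] bump g I :=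
  h.weight.volume_ac.ae_le (h.memLp_bump I).coeFn_toLp

theorem inner_aux (h : IsTestPair m g) (I : DyadicLabel) (f : L2 m) :
    (fun x => m x • inner ℂ (h.testVec I x) (f x)) =ᵐ[volume]
      (ivl I).indicator fun x => ((m x * g x : ℝ) : ℂ) * f x := by
  filter_upwards [h.coeFn_testVec I] with x hx
  rw [hx, bump]
  by_cases hx : x ∈ ivl I
  · simp [hx]
    ring
  · simp [hx]

theorem integrableOn_mul (h : IsTestPair m g) (I : DyadicLabel) (f : L2 m) :
    IntegrableOn (fun x => ((m x * g x : ℝ) : ℂ) * f x) (ivl I) volume := by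
  rw [← integrable_indicator_iff (measurableSet_ivl I)]
  exact (h.weight.integrable_weightMeasure.1 (L2.integrable_inner (h.testVec I) f)).congr
    (h.inner_aux I f)

theorem inner_testVec (h : IsTestPair m g) (I : DyadicLabel) (f : L2 m) :
    inner ℂ (h.testVec I) f = ∫ x in ivl I, ((m x * g x : ℝ) : ℂ) * f x := by
  rw [L2.inner_def, h.weight.integral_weightMeasure, ← integral_indicator (measurableSet_ivl I)]
  refine integral_congr_ae ?_
  filter_upwards [h.inner_aux I f] with x hx
  rw [← hx, Complex.real_smul]

theorem inner_testVec_testVec (h : IsTestPair m g) (I J : DyadicLabel) :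
    inner ℂ (h.testVec J) (h.testVec I) = ((∫ x in ivl J ∩ ivl I, m x * g x ^ 2 : ℝ) : ℂ) := by
  rw [inner_testVec, ← integral_complex_ofReal, ← setIntegral_indicator (measurableSet_ivl I)]
  refine setIntegral_congr_ae (measurableSet_ivl J) ?_
  filter_upwards [h.coeFn_testVec I] with x hx _
  rw [hx, bump]
  by_cases hx : x ∈ ivl I
  · simp [hx]
    ring
  · simp [hx]

theorem norm_sq_testVec (h : IsTestPair m g) (I : DyadicLabel) :
    ‖h.testVec I‖ ^ 2 = ∫ x in ivl I, m x * g x ^ 2 := by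
  have h1 := h.inner_testVec_testVec I I
  rw [inner_self_eq_norm_sq_to_K, inter_self] at h1
  apply Complex.ofReal_injective
  rw [← h1]
  push_cast
  rfl

theorem inner_testVec_of_subset (h : IsTestPair m g) {I J : DyadicLabel} (hJ : ivl J ⊆ ivl I) :
    inner ℂ (h.testVec J) (h.testVec I) = ((‖h.testVec J‖ ^ 2 : ℝ) : ℂ) := by
  rw [inner_testVec_testVec, inter_eq_left.2 hJ, norm_sq_testVec]

theorem dyadicSystem (h : IsTestPair m g) : DyadicSystem h.testVec where
  split I := by
    rw [testVec, testVec, testVec, ← MemLp.toLp_add]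
    congr 1
    rw [bump, ← ivl_left_union_right I, indicator_union_of_disjoint (disjoint_ivl_left_right I)]
    rfl
  orth j k k' hk := by
    rw [inner_testVec_testVec, (disjoint_ivl_of_ne hk).inter_eq]
    simp
  ne_zero I h0 := by
    have h1 := h.norm_sq_testVec I
    rw [h0] at h1
    have h2 : ∀ᵐ x, 0 < m x * g x ^ 2 := by
      filter_upwards [h.weight.ae_pos, h.ae_pos] with x h1 h2
      positivity
    have := integral_ivl_pos h2 (h.integrableOn I)
    simp at h1
    linarith

/-- Passing from `f` to `|f|` dominates all coefficients. -/
theorem exists_dominating (h : IsTestPair m g) (f : L2 m) :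
    ∃ f' : L2 m, ‖f'‖ = ‖f‖ ∧ ∀ I, ∃ r : ℝ, inner ℂ (h.testVec I) f' = (r : ℂ) ∧
      ‖inner ℂ (h.testVec I) f‖ ≤ r := by
  have hf : MemLp (fun x => ((‖f x‖ : ℝ) : ℂ)) 2 (weightMeasure m) :=
    (Lp.memLp f).norm.ofReal
  refine ⟨hf.toLp, ?_, fun I => ⟨∫ x in ivl I, m x * g x * ‖f x‖, ?_, ?_⟩⟩
  · rw [Lp.norm_toLp, Lp.norm_def]
    congr 1
    exact eLpNorm_congr_norm_ae (Filter.Eventually.of_forall fun x => by simp)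
  · rw [inner_testVec, ← integral_complex_ofReal]
    refine setIntegral_congr_ae (measurableSet_ivl I) ?_
    filter_upwards [h.weight.volume_ac.ae_le hf.coeFn_toLp] with x hx _
    rw [hx]
    push_cast
    rfl
  · rw [inner_testVec]
    refine (norm_integral_le_integral_norm _).trans (le_of_eq ?_)
    refine setIntegral_congr_ae (measurableSet_ivl I) ?_
    filter_upwards [h.weight.ae_pos, h.ae_pos] with x h1 h2 _
    rw [norm_mul, Complex.norm_real, Real.norm_of_nonneg (by positivity)]

end IsTestPair

/-! ### Dictionary between weighted operators and dyadic systems -/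

theorem invW_aemeasurable {u : ℝ → ℝ} (hu : IsWeight u) : AEMeasurable (invW u) volume :=
  hu.aemeasurable.inv

theorem invW_ae_pos {u : ℝ → ℝ} (hu : IsWeight u) : ∀ᵐ x, 0 < invW u x := by
  filter_upwards [hu.ae_pos] with x hx
  exact inv_pos.2 hx

theorem vw_aemeasurable {v w : ℝ → ℝ} (t : ℝ) (hv : IsWeight v) (hw : IsWeight w) :
    AEMeasurable (vw t v w) volume :=
  hv.aemeasurable.mul (hw.aemeasurable.pow_const _)

theorem vw_ae_pos {v w : ℝ → ℝ} (t : ℝ) (hv : IsWeight v) (hw : IsWeight w) :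
    ∀ᵐ x, 0 < vw t v w x := by
  filter_upwards [hv.ae_pos, hw.ae_pos] with x h1 h2
  exact mul_pos h1 (Real.rpow_pos_of_pos h2 _)

theorem mul_invW_sq_ae {u : ℝ → ℝ} (hu : IsWeight u) :
    (fun x => u x * invW u x ^ 2) =ᵐ[volume] invW u := by
  filter_upwards [hu.ae_pos] with x hx
  rw [invW]
  field_simp

theorem mul_rpow_sq_ae {v w : ℝ → ℝ} (t : ℝ) (hw : IsWeight w) :
    (fun x => v x * (w x ^ t) ^ 2) =ᵐ[volume] vw t v w := by
  filter_upwards [hw.ae_pos] with x hx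
  rw [vw, mul_comm 2 t, Real.rpow_mul hx.le]
  norm_cast

/-- The choice `g = u⁻¹` makes `u g² = u⁻¹`, and the pairing of `1_I g` with `f` in `L²(u)` is the
unweighted integral of `f` over `I`. -/
theorem isTestPair_invW {u : ℝ → ℝ} (hu : IsWeight u)
    (h : ∀ I, IntegrableOn (invW u) (ivl I) volume) : IsTestPair u (invW u) where
  weight := hu
  aemeasurable := invW_aemeasurable hu
  ae_pos := invW_ae_pos hu
  integrableOn I := (h I).congr (ae_restrict_of_ae (mul_invW_sq_ae hu).symm)

theorem isTestPair_rpow {v w : ℝ → ℝ} {t : ℝ} (hv : IsWeight v) (hw : IsWeight w)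
    (h : ∀ I, IntegrableOn (vw t v w) (ivl I) volume) : IsTestPair v (fun x => w x ^ t) where
  weight := hv
  aemeasurable := hw.aemeasurable.pow_const _
  ae_pos := hw.ae_pos.mono fun _ hx => Real.rpow_pos_of_pos hx _
  integrableOn I := (h I).congr (ae_restrict_of_ae (mul_rpow_sq_ae t hw).symm)

theorem norm_sq_toLp {m : ℝ → ℝ} (hm : IsWeight m) {F : ℝ → ℂ} (hF : MemLp F 2 (weightMeasure m)) :
    ‖hF.toLp‖ ^ 2 = ∫ x, m x * ‖F x‖ ^ 2 := by
  have h1 : inner ℂ hF.toLp hF.toLp = ((∫ x, m x * ‖F x‖ ^ 2 : ℝ) : ℂ) := by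
    rw [L2.inner_def, hm.integral_weightMeasure, ← integral_complex_ofReal]
    refine integral_congr_ae ?_
    filter_upwards [hm.volume_ac.ae_le hF.coeFn_toLp] with x hx
    rw [hx, inner_self_eq_norm_sq_to_K]
    push_cast
    rfl
  apply Complex.ofReal_injective
  rw [← h1, inner_self_eq_norm_sq_to_K]
  push_cast
  rfl

theorem avg_real (a : ℝ → ℝ) (I : DyadicLabel) : avg a I = (∫ x in ivl I, a x) / len I := by
  rw [avg, smul_eq_mul, inv_mul_eq_div]

theorem avg_complex (f : ℝ → ℂ) (I : DyadicLabel) :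
    avg f I = (∫ x in ivl I, f x) / (len I : ℂ) := by
  rw [avg, Complex.real_smul, Complex.ofReal_inv, inv_mul_eq_div]

theorem delta_eq (a : ℝ → ℝ) (I : DyadicLabel) :
    delta a I = 2 * ((∫ x in ivl (right I), a x) - ∫ x in ivl (left I), a x) / len I := by
  have := len_pos I
  rw [delta, avg_real, avg_real, len_left, len_right]
  field_simp

theorem IsWeight.avg_pos {w : ℝ → ℝ} (hw : IsWeight w) (I : DyadicLabel) : 0 < avg w I := by
  rw [avg_real]
  exact div_pos (integral_ivl_pos hw.ae_pos (hw.integrableOn_ivl I)) (len_pos I)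

theorem haar_eq (I : DyadicLabel) (x : ℝ) : haar I x = (√(len I))⁻¹ *
    ((ivl (right I)).indicator (fun _ => (1 : ℝ)) x -
      (ivl (left I)).indicator (fun _ => (1 : ℝ)) x) := rfl

theorem measurable_haar (I : DyadicLabel) : Measurable (haar I) :=
  ((measurable_const.indicator (measurableSet_ivl _)).sub
    (measurable_const.indicator (measurableSet_ivl _))).const_mul _

theorem haar_sq (I : DyadicLabel) (x : ℝ) :
    haar I x ^ 2 = (ivl I).indicator (fun _ => (len I)⁻¹) x := by
  rw [haar_eq, mul_pow, inv_pow, Real.sq_sqrt (len_pos I).le, ← ivl_left_union_right I]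
  by_cases h1 : x ∈ ivl (left I)
  · have h2 := Set.disjoint_left.1 (disjoint_ivl_left_right I) h1
    simp [h1, h2]
  · by_cases h2 : x ∈ ivl (right I) <;> simp [h1, h2]

theorem haarCoeff_eq {f : ℝ → ℂ} {I : DyadicLabel} (hf : IntegrableOn f (ivl I) volume) :
    haarCoeff f I = ((√(len I))⁻¹ : ℝ) *
      ((∫ x in ivl (right I), f x) - ∫ x in ivl (left I), f x) := by
  have hr := hf.mono_set (ivl_right_subset I)
  have hl := hf.mono_set (ivl_left_subset I)
  rw [← integrable_indicator_iff (measurableSet_ivl _)] at hr hl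
  rw [← integral_indicator (measurableSet_ivl _), ← integral_indicator (measurableSet_ivl _),
    ← integral_sub hr hl, ← integral_const_mul, haarCoeff]
  refine integral_congr_ae (Filter.Eventually.of_forall fun x => ?_)
  simp only [haar_eq]
  by_cases h1 : x ∈ ivl (left I)
  · have h2 := Set.disjoint_left.1 (disjoint_ivl_left_right I) h1
    simp [h1, h2]
    ring
  · by_cases h2 : x ∈ ivl (right I)
    · simp [h1, h2]
      ring
    · simp [h1, h2]

theorem eavg_eq {a : ℝ → ℝ} (ha : ∀ᵐ x, 0 < a x) {I : DyadicLabel}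
    (hint : IntegrableOn a (ivl I) volume) :
    eavg a I = ENNReal.ofReal ((∫ x in ivl I, a x) / len I) := by
  rw [eavg, ENNReal.ofReal_div_of_pos (len_pos I), ofReal_integral_eq_lintegral_ofReal hint
    (ae_restrict_of_ae (ha.mono fun _ hx => hx.le))]

/-- The normalized multiplier `⟨w⟩_I^{-t} / |I|`. -/
noncomputable def multCoeff (t : ℝ) (w : ℝ → ℝ) (I : DyadicLabel) : ℝ := avg w I ^ (-t) / len I

theorem multCoeff_pos (t : ℝ) {w : ℝ → ℝ} (hw : IsWeight w) (I : DyadicLabel) :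
    0 < multCoeff t w I :=
  div_pos (Real.rpow_pos_of_pos (hw.avg_pos I) _) (len_pos I)

theorem multCoeff_sq (t : ℝ) {w : ℝ → ℝ} (hw : IsWeight w) (I : DyadicLabel) :
    multCoeff t w I ^ 2 = (len I ^ 2 * avg w I ^ (2 * t))⁻¹ := by
  have h := hw.avg_pos I
  have h2 : avg w I ^ (2 * t) = (avg w I ^ t) ^ 2 := by
    rw [mul_comm, Real.rpow_mul h.le]
    norm_cast
  rw [multCoeff, Real.rpow_neg h.le, h2]
  have := len_pos I
  have := Real.rpow_pos_of_pos h t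
  field_simp

/-- Once the pointwise terms agree almost everywhere with elements of `L²(v)`, membership is
automatic and only convergence of the abstract series remains. -/
theorem represents_iff {A : DyadicLabel → (ℝ → ℂ) → ℝ → ℂ} {u v : ℝ → ℝ}
    {Z : DyadicLabel → L2 u → L2 v}
    (hint : ∀ (f : L2 u) I, IntegrableOn (f : ℝ → ℂ) (ivl I) volume)
    (hZ : ∀ I (f : L2 u), A I f =ᵐ[weightMeasure v] Z I f) (L : L2 u →L[ℂ] L2 v) :
    Represents A u v L ↔ ∀ f, HasSum (fun I => Z I f) (L f) := by
  have hmem : ∀ I (f : L2 u), MemLp (A I f) 2 (weightMeasure v) := fun I f =>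
    (Lp.memLp (Z I f)).ae_eq (hZ I f).symm
  have heq : ∀ I (f : L2 u) (h : MemLp (A I f) 2 (weightMeasure v)), h.toLp = Z I f := by
    intro I f h
    exact Lp.ext (h.coeFn_toLp.trans (hZ I f))
  constructor
  · intro h f
    obtain ⟨-, h', hs⟩ := h f
    simpa only [heq] using hs
  · intro h f
    refine ⟨hint f, fun I => hmem I f, ?_⟩
    simpa only [heq] using h f

/-- Sums in `L²(v)` are unique, so the infimum ranges over one operator. -/
theorem Represents.opNorm_eq {A : DyadicLabel → (ℝ → ℂ) → ℝ → ℂ} {u v : ℝ → ℝ}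
    {L : L2 u →L[ℂ] L2 v} (h : Represents A u v L) : opNorm A u v = ‖L‖ₑ := by
  refine le_antisymm (iInf₂_le L h) (le_iInf₂ fun L' h' => le_of_eq ?_)
  congr 1
  ext1 f
  obtain ⟨-, h1, hs⟩ := h f
  obtain ⟨-, h1', hs'⟩ := h' f
  exact hs.unique hs'

theorem opNorm_lt_top_iff {A : DyadicLabel → (ℝ → ℂ) → ℝ → ℂ} {u v : ℝ → ℝ} :
    opNorm A u v < ∞ ↔ IsBoundedOp A u v := by
  constructor
  · intro h
    simp only [opNorm, iInf_lt_iff] at h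
    obtain ⟨L, hL, -⟩ := h
    exact ⟨L, hL⟩
  · rintro ⟨L, hL⟩
    rw [hL.opNorm_eq]
    exact enorm_lt_top

theorem norm_sq_testVec_invW {u : ℝ → ℝ} (hu : IsWeight u)
    (ha : ∀ I, IntegrableOn (invW u) (ivl I) volume)
    (I : DyadicLabel) :
    ‖(isTestPair_invW hu ha).testVec I‖ ^ 2 = ∫ x in ivl I, invW u x := by
  rw [IsTestPair.norm_sq_testVec]
  exact integral_congr_ae (ae_restrict_of_ae (mul_invW_sq_ae hu))

theorem norm_sq_testVec_rpow {t : ℝ} {v w : ℝ → ℝ} (hv : IsWeight v) (hw : IsWeight w)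
    (hb : ∀ I, IntegrableOn (vw t v w) (ivl I) volume)
    (I : DyadicLabel) :
    ‖(isTestPair_rpow hv hw hb).testVec I‖ ^ 2 = ∫ x in ivl I, vw t v w x := by
  rw [IsTestPair.norm_sq_testVec]
  exact integral_congr_ae (ae_restrict_of_ae (mul_rpow_sq_ae t hw))

theorem mul_invW_mul_ae {u : ℝ → ℝ} (hu : IsWeight u) (f : ℝ → ℂ) :
    (fun x => ((u x * invW u x : ℝ) : ℂ) * f x) =ᵐ[volume] f := by
  filter_upwards [hu.ae_pos] with x hx
  rw [invW, mul_inv_cancel₀ hx.ne']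
  simp

theorem integrableOn_of_L2 {u : ℝ → ℝ} (hu : IsWeight u)
    (ha : ∀ I, IntegrableOn (invW u) (ivl I) volume)
    (f : L2 u) (I : DyadicLabel) :
    IntegrableOn (f : ℝ → ℂ) (ivl I) volume :=
  ((isTestPair_invW hu ha).integrableOn_mul I f).congr (ae_restrict_of_ae (mul_invW_mul_ae hu f))

theorem inner_testVec_invW {u : ℝ → ℝ} (hu : IsWeight u)
    (ha : ∀ I, IntegrableOn (invW u) (ivl I) volume)
    (f : L2 u) (I : DyadicLabel) :
    inner ℂ ((isTestPair_invW hu ha).testVec I) f = ∫ x in ivl I, f x := by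
  rw [IsTestPair.inner_testVec]
  exact integral_congr_ae (ae_restrict_of_ae (mul_invW_mul_ae hu f))

/-- The two factors `|I|^{-1/2}`, from the coefficient and from the Haar function, combine to the
`|I|⁻¹` in `multCoeff`. -/
theorem haarTerm_ae_eq {t : ℝ} {u v w : ℝ → ℝ} (hu : IsWeight u) (hv : IsWeight v) (hw : IsWeight w)
    (ha : ∀ I, IntegrableOn (invW u) (ivl I) volume)
    (hb : ∀ I, IntegrableOn (vw t v w) (ivl I) volume)
    (σ : DyadicLabel → ℤˣ) (I : DyadicLabel) (f : L2 u) :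
    haarTerm t w σ I f =ᵐ[weightMeasure v]
      (((σ I : ℤ) : ℂ) • haarRankOne (multCoeff t w) (isTestPair_invW hu ha).testVec
        (isTestPair_rpow hv hw hb).testVec I f : L2 v) := by
  set i := (isTestPair_invW hu ha).testVec
  set l := (isTestPair_rpow hv hw hb).testVec
  have h1 : haarCoeff f I = ((√(len I))⁻¹ : ℝ) * inner ℂ (i (right I) - i (left I)) f := by
    rw [haarCoeff_eq (integrableOn_of_L2 hu ha f I), inner_sub_left, inner_testVec_invW hu ha,
      inner_testVec_invW hu ha]
  have ac := IsWeight.ac_volume v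
  rw [haarRankOne, smul_smul]
  filter_upwards [Lp.coeFn_smul (((σ I : ℤ) : ℂ) * ((multCoeff t w I : ℂ) *
      inner ℂ (i (right I) - i (left I)) f)) (l (right I) - l (left I)),
    Lp.coeFn_sub (l (right I)) (l (left I)),
    ac.ae_le ((isTestPair_rpow hv hw hb).coeFn_testVec (right I)),
    ac.ae_le ((isTestPair_rpow hv hw hb).coeFn_testVec (left I)),
    ac.ae_le hw.ae_pos] with x e1 e2 e3 e4 hx
  rw [e1, Pi.smul_apply, e2, Pi.sub_apply, e3, e4, haarTerm, h1, smul_eq_mul]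
  have h2 : bump (fun x => w x ^ t) (right I) x - bump (fun x => w x ^ t) (left I) x =
      ((w x ^ t : ℝ) : ℂ) * ((√(len I) * haar I x : ℝ) : ℂ) := by
    have := Real.sqrt_pos.2 (len_pos I)
    rw [haar_eq, mul_inv_cancel_left₀ this.ne', bump, bump]
    by_cases h1 : x ∈ ivl (left I) <;> by_cases h2 : x ∈ ivl (right I) <;> simp [h1, h2]
  rw [h2, multCoeff, Real.div_rpow hx.le (hw.avg_pos I).le, Real.rpow_neg (hw.avg_pos I).le]
  have hl : (len I : ℂ) = √(len I) * √(len I) := by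
    rw [← Complex.ofReal_mul, Real.mul_self_sqrt (len_pos I).le]
  have hl0 : (√(len I) : ℂ) ≠ 0 := by
    exact_mod_cast (Real.sqrt_pos.2 (len_pos I)).ne'
  push_cast
  rw [hl]
  field_simp

theorem massDiff_testVec_invW {u : ℝ → ℝ} (hu : IsWeight u)
    (ha : ∀ I, IntegrableOn (invW u) (ivl I) volume)
    (I : DyadicLabel) :
    massDiff (isTestPair_invW hu ha).testVec I = delta (invW u) I * len I / 2 := by
  have := len_pos I
  rw [massDiff, norm_sq_testVec_invW hu ha, norm_sq_testVec_invW hu ha, delta_eq]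
  field_simp

theorem massDiff_testVec_rpow {t : ℝ} {v w : ℝ → ℝ} (hv : IsWeight v) (hw : IsWeight w)
    (hb : ∀ I, IntegrableOn (vw t v w) (ivl I) volume)
    (I : DyadicLabel) :
    massDiff (isTestPair_rpow hv hw hb).testVec I = delta (vw t v w) I * len I / 2 := by
  have := len_pos I
  rw [massDiff, norm_sq_testVec_rpow hv hw hb, norm_sq_testVec_rpow hv hw hb, delta_eq]
  field_simp

theorem lam_eq {t : ℝ} {u v w : ℝ → ℝ} (hu : IsWeight u) (hv : IsWeight v) (hw : IsWeight w)
    (ha : ∀ I, IntegrableOn (invW u) (ivl I) volume)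
    (hb : ∀ I, IntegrableOn (vw t v w) (ivl I) volume)
    (I : DyadicLabel) :
    lam t u v w I = len I ^ 2 * posCoeff (multCoeff t w) (isTestPair_invW hu ha).testVec
      (isTestPair_rpow hv hw hb).testVec I := by
  have hA := integral_ivl_pos (invW_ae_pos hu) (ha I)
  have hB := integral_ivl_pos (vw_ae_pos t hv hw) (hb I)
  have hl := len_pos I
  have hW := Real.rpow_pos_of_pos (hw.avg_pos I) t
  rw [posCoeff, massDiff_testVec_invW hu ha, massDiff_testVec_rpow hv hw hb, norm_sq_testVec_invW hu ha,
    norm_sq_testVec_rpow hv hw hb, lam, avg_real, avg_real, multCoeff, Real.rpow_neg (hw.avg_pos I).le]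
  simp only [abs_div, abs_mul, abs_of_pos hl, abs_two]
  field_simp
  ring

theorem posTerm_ae_eq {t : ℝ} {u v w : ℝ → ℝ} (hu : IsWeight u) (hv : IsWeight v) (hw : IsWeight w)
    (ha : ∀ I, IntegrableOn (invW u) (ivl I) volume)
    (hb : ∀ I, IntegrableOn (vw t v w) (ivl I) volume)
    (I : DyadicLabel) (f : L2 u) :
    posTerm t u v w I f =ᵐ[weightMeasure v]
      (((posCoeff (multCoeff t w) (isTestPair_invW hu ha).testVec
        (isTestPair_rpow hv hw hb).testVec I : ℂ) *
          inner ℂ ((isTestPair_invW hu ha).testVec I) f) •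
        (isTestPair_rpow hv hw hb).testVec I : L2 v) := by
  have ac := IsWeight.ac_volume v
  filter_upwards [Lp.coeFn_smul ((posCoeff (multCoeff t w) (isTestPair_invW hu ha).testVec
        (isTestPair_rpow hv hw hb).testVec I : ℂ) *
          inner ℂ ((isTestPair_invW hu ha).testVec I) f) ((isTestPair_rpow hv hw hb).testVec I),
    ac.ae_le ((isTestPair_rpow hv hw hb).coeFn_testVec I)] with x e1 e2
  rw [e1, Pi.smul_apply, e2, posTerm, lam_eq hu hv hw ha hb, inner_testVec_invW hu ha, avg_complex,
    smul_eq_mul, bump]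
  have hl0 : (len I : ℂ) ≠ 0 := by exact_mod_cast (len_pos I).ne'
  by_cases hx : x ∈ ivl I
  · simp only [hx, indicator_of_mem, mul_one]
    push_cast
    field_simp
  · simp [hx]

/-! ### Local integrability from uniform bounds -/

theorem haarTerm_eq_sign_mul (t : ℝ) (w : ℝ → ℝ) (σ : DyadicLabel → ℤˣ) (I : DyadicLabel)
    (f : ℝ → ℂ) : haarTerm t w σ I f = ((σ I : ℤ) : ℂ) • haarTerm t w 1 I f := by
  funext x
  simp only [haarTerm, Pi.smul_apply, Pi.one_apply, Units.val_one, Int.cast_one, smul_eq_mul]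
  ring

/-- Uniform bounds for the multipliers bound the individual terms. -/
theorem norm_haarTerm_le {t : ℝ} {u v w : ℝ → ℝ} {M : ℝ}
    (h : ∀ σ, ∃ L, Represents (haarTerm t w σ) u v L ∧ ‖L‖ ≤ M) (I : DyadicLabel) (f : L2 u) :
    ∃ hm : MemLp (haarTerm t w 1 I f) 2 (weightMeasure v), ‖hm.toLp‖ ≤ M * ‖f‖ := by
  obtain ⟨L₁, hL₁, -⟩ := h 1
  obtain ⟨-, hm, -⟩ := hL₁ f
  refine ⟨hm I, ?_⟩
  have key := norm_signed_sum_le (z := fun J => (hm J).toLp) (M := M * ‖f‖) (fun σ => ?_) {I} 1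
  · simpa using key
  · obtain ⟨L, hL, hLM⟩ := h σ
    obtain ⟨-, hm', hs⟩ := hL f
    refine ⟨L f, ?_, (L.le_opNorm f).trans (by gcongr)⟩
    convert hs using 2 with J
    rw [← MemLp.toLp_const_smul]
    congr 1
    exact (haarTerm_eq_sign_mul t w σ J f).symm

/-- The test function is `u⁻¹ √|I| h_I` cut off to `G`. Its squared norm is `e = ∫_G u⁻¹` and its
Haar coefficient is `e / √|I|`, so the term bound reads `e² s_I² ∫_I v w^{2t} ≤ M² e`; dividing by
`e` gives the claim. -/
theorem haarTerm_test {t : ℝ} {u v w : ℝ → ℝ} (hu : IsWeight u) (hv : IsWeight v) (hw : IsWeight w)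
    {M : ℝ} {I : DyadicLabel}
    (h : ∀ f : L2 u, ∃ hm : MemLp (haarTerm t w 1 I f) 2 (weightMeasure v), ‖hm.toLp‖ ≤ M * ‖f‖)
    {G : Set ℝ} (hG : MeasurableSet G) (hGI : G ⊆ ivl I) (ha : IntegrableOn (invW u) G volume)
    (hpos : 0 < ∫ x in G, invW u x) :
    IntegrableOn (vw t v w) (ivl I) volume ∧
      (∫ x in G, invW u x) * (multCoeff t w I ^ 2 * ∫ x in ivl I, vw t v w x) ≤ M ^ 2 := by
  set e := ∫ x in G, invW u x with he
  have hl := len_pos I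
  have hsq : √(len I) ^ 2 = len I := Real.sq_sqrt hl.le
  have hsl := Real.sqrt_pos.2 hl
  have hh : ∀ x ∈ G, haar I x ^ 2 = (len I)⁻¹ := fun x hx => by
    rw [haar_sq, indicator_of_mem (hGI hx)]
  let F : ℝ → ℂ := G.indicator fun x => ((invW u x * (√(len I) * haar I x) : ℝ) : ℂ)
  have hFm : AEStronglyMeasurable F volume :=
    (Complex.measurable_ofReal.comp_aemeasurable ((invW_aemeasurable hu).mul
      ((measurable_haar I).const_mul _).aemeasurable)).aestronglyMeasurable.indicator hG
  have hF2 : (fun x => u x * ‖F x‖ ^ 2) =ᵐ[volume] G.indicator (invW u) := by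
    filter_upwards [hu.ae_pos] with x hx
    by_cases hxG : x ∈ G
    · simp only [F, indicator_of_mem hxG, Complex.norm_real, Real.norm_eq_abs, sq_abs, mul_pow,
        hh x hxG, hsq, invW]
      field_simp
    · simp [F, hxG]
  have hF : MemLp F 2 (weightMeasure u) := by
    rw [memLp_two_weightMeasure_iff hu hFm]
    exact ((integrable_indicator_iff hG).2 ha).congr hF2.symm
  have hnorm : ‖hF.toLp‖ ^ 2 = e := by
    rw [norm_sq_toLp hu, integral_congr_ae hF2, integral_indicator hG]
  have hcoeff : haarCoeff hF.toLp I = ((e / √(len I) : ℝ) : ℂ) := by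
    rw [he, ← integral_div, ← integral_indicator hG, ← integral_complex_ofReal, haarCoeff]
    refine integral_congr_ae ?_
    filter_upwards [hu.volume_ac.ae_le hF.coeFn_toLp] with x hx
    rw [hx]
    by_cases hxG : x ∈ G
    · simp only [F, indicator_of_mem hxG]
      rw [← Complex.ofReal_mul]
      congr 1
      have : invW u x * (√(len I) * haar I x) * haar I x =
        invW u x * √(len I) * haar I x ^ 2 := by ring
      rw [this, hh x hxG]
      nth_rw 2 [← hsq]
      field_simp
    · simp [F, hxG]
  obtain ⟨hm, hM⟩ := h hF.toLp
  have hc : e ^ 2 * multCoeff t w I ^ 2 ≠ 0 := by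
    have := multCoeff_pos t hw I
    positivity
  have hT : (fun x => v x * ‖haarTerm t w 1 I hF.toLp x‖ ^ 2) =ᵐ[volume]
      (ivl I).indicator fun x => e ^ 2 * multCoeff t w I ^ 2 * vw t v w x := by
    filter_upwards [hw.ae_pos, mul_rpow_sq_ae (v := v) t hw] with x hx hx2
    have e1 : ‖haarTerm t w 1 I hF.toLp x‖ ^ 2 =
        ((w x / avg w I) ^ t) ^ 2 * (e / √(len I)) ^ 2 * haar I x ^ 2 := by
      simp only [haarTerm, hcoeff, norm_mul, mul_pow, Complex.norm_real, Real.norm_eq_abs, sq_abs,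
        Pi.one_apply, Units.val_one, Int.cast_one, one_mul]
    rw [e1, haar_sq]
    by_cases hxI : x ∈ ivl I
    · rw [indicator_of_mem hxI, indicator_of_mem hxI, ← hx2, multCoeff,
        Real.div_rpow hx.le (hw.avg_pos I).le, Real.rpow_neg (hw.avg_pos I).le, div_pow e, hsq]
      ring
    · rw [indicator_of_notMem hxI, indicator_of_notMem hxI]
      ring
  have haest : AEStronglyMeasurable (haarTerm t w 1 I hF.toLp) volume :=
    hm.aestronglyMeasurable.mono_ac hv.volume_ac
  have hint := ((memLp_two_weightMeasure_iff hv haest).1 hm).congr hT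
  rw [integrable_indicator_iff (measurableSet_ivl I)] at hint
  refine ⟨(integrable_const_mul_iff (isUnit_iff_ne_zero.2 hc) _).1 hint, ?_⟩
  have hn2 : ‖hm.toLp‖ ^ 2 = e ^ 2 * multCoeff t w I ^ 2 * ∫ x in ivl I, vw t v w x := by
    rw [norm_sq_toLp hv, integral_congr_ae hT, integral_indicator (measurableSet_ivl I),
      integral_const_mul]
  have h3 : ‖hm.toLp‖ ^ 2 ≤ M ^ 2 * e := by
    rw [← hnorm, ← mul_pow]
    gcongr
  rw [hn2] at h3
  refine le_of_mul_le_mul_right ?_ hpos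
  linarith

/-- `I` is exhausted by sets `G n` on which `u⁻¹` is integrable. One of positive mass already makes
`v w^{2t}` integrable on `I`; the test inequality then bounds all `∫_{G n} u⁻¹` uniformly, and
monotone limits finish. -/
theorem integrableOn_of_bounds {t : ℝ} {u v w : ℝ → ℝ} (hu : IsWeight u) (hv : IsWeight v)
    (hw : IsWeight w) {M : ℝ} {I : DyadicLabel}
    (h : ∀ f : L2 u, ∃ hm : MemLp (haarTerm t w 1 I f) 2 (weightMeasure v),
      ‖hm.toLp‖ ≤ M * ‖f‖) :
    IntegrableOn (invW u) (ivl I) volume ∧ IntegrableOn (vw t v w) (ivl I) volume := by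
  set ρ := weightMeasure (invW u) with hρ
  have : SigmaFinite ρ := SigmaFinite.withDensity_ofReal _
  let G : ℕ → Set ℝ := fun n => spanningSets ρ n ∩ ivl I
  have hGm : ∀ n, MeasurableSet (G n) := fun n =>
    (measurableSet_spanningSets ρ n).inter (measurableSet_ivl I)
  have hpos0 : 0 ≤ᵐ[volume] invW u := (invW_ae_pos hu).mono fun _ hx => hx.le
  have hρS : ∀ S : Set ℝ, ρ S = ∫⁻ x in S, ENNReal.ofReal (invW u x) := fun S =>
    withDensity_apply' _ _
  have hintS : ∀ S : Set ℝ, ρ S < ∞ → IntegrableOn (invW u) S volume := fun S hS =>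
    ⟨(invW_aemeasurable hu).aestronglyMeasurable.restrict,
      (hasFiniteIntegral_iff_ofReal (ae_restrict_of_ae hpos0)).2 (by rwa [← hρS])⟩
  have hGlt : ∀ n, ρ (G n) < ∞ := fun n =>
    (measure_mono inter_subset_left).trans_lt (measure_spanningSets_lt_top ρ n)
  have hGint : ∀ n, ρ (G n) = ENNReal.ofReal (∫ x in G n, invW u x) := fun n => by
    rw [hρS, ofReal_integral_eq_lintegral_ofReal (hintS _ (hGlt n)) (ae_restrict_of_ae hpos0)]
  have hsup : ρ (ivl I) = ⨆ n, ρ (G n) := by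
    rw [← Monotone.measure_iUnion, ← iUnion_inter, iUnion_spanningSets, univ_inter]
    exact fun a b hab => inter_subset_inter_left _ (monotone_spanningSets ρ hab)
  have hIpos : ρ (ivl I) ≠ 0 := by
    intro h0
    have hac : (volume : Measure ℝ) ≪ ρ := by
      refine withDensity_absolutelyContinuous' (invW_aemeasurable hu).ennreal_ofReal ?_
      filter_upwards [invW_ae_pos hu] with x hx
      simpa using hx
    have := hac h0
    rw [volume_ivl] at this
    simp only [ENNReal.ofReal_eq_zero] at this
    linarith [len_pos I]
  obtain ⟨n, hn⟩ : ∃ n, 0 < ∫ x in G n, invW u x := by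
    by_contra! hcon
    apply hIpos
    rw [hsup]
    simp only [hGint, ENNReal.iSup_eq_zero]
    exact fun n => ENNReal.ofReal_of_nonpos (hcon n)
  have hB := (haarTerm_test hu hv hw h (hGm n) inter_subset_right (hintS _ (hGlt n)) hn).1
  refine ⟨hintS _ ?_, hB⟩
  have hD : 0 < multCoeff t w I ^ 2 * ∫ x in ivl I, vw t v w x :=
    mul_pos (pow_pos (multCoeff_pos t hw I) 2) (integral_ivl_pos (vw_ae_pos t hv hw) hB)
  refine lt_of_le_of_lt ?_ (ENNReal.ofReal_lt_top
    (r := M ^ 2 / (multCoeff t w I ^ 2 * ∫ x in ivl I, vw t v w x)))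
  rw [hsup]
  refine iSup_le fun k => ?_
  rw [hGint]
  refine ENNReal.ofReal_le_ofReal ?_
  rcases le_or_gt (∫ x in G k, invW u x) 0 with hk | hk
  · exact hk.trans (by positivity)
  · rw [le_div_iff₀ hD]
    exact (haarTerm_test hu hv hw h (hGm k) inter_subset_right (hintS _ (hGlt k)) hk).2

/-! ### The joint and Carleson constants in terms of masses -/

theorem joint_term_eq {t : ℝ} {u v w : ℝ → ℝ} (hu : IsWeight u) (hv : IsWeight v)
    (hw : IsWeight w) {I : DyadicLabel} (ha : IntegrableOn (invW u) (ivl I) volume)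
    (hb : IntegrableOn (vw t v w) (ivl I) volume) :
    eavg (invW u) I * eavg (vw t v w) I / ENNReal.ofReal ((avg w I) ^ (2 * t)) =
      ENNReal.ofReal (multCoeff t w I ^ 2 * (∫ x in ivl I, invW u x) *
        ∫ x in ivl I, vw t v w x) := by
  have hW := Real.rpow_pos_of_pos (hw.avg_pos I) (2 * t)
  have hA := integral_ivl_pos (invW_ae_pos hu) ha
  have hl := len_pos I
  rw [eavg_eq (invW_ae_pos hu) ha, eavg_eq (vw_ae_pos t hv hw) hb,
    ← ENNReal.ofReal_mul (by positivity), ← ENNReal.ofReal_div_of_pos hW, multCoeff_sq t hw]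
  congr 1
  field_simp

theorem lintegral_ivl_ne_zero {a : ℝ → ℝ} (ha : AEMeasurable a volume) (hpos : ∀ᵐ x, 0 < a x)
    (I : DyadicLabel) : ∫⁻ x in ivl I, ENNReal.ofReal (a x) ≠ 0 := by
  intro h0
  rw [lintegral_eq_zero_iff' ha.ennreal_ofReal.restrict] at h0
  have h1 : ∀ᵐ x ∂(volume.restrict (ivl I)), False := by
    filter_upwards [h0, ae_restrict_of_ae hpos] with x hx hx'
    simp only [Pi.zero_apply, ENNReal.ofReal_eq_zero] at hx
    linarith
  rw [ae_iff] at h1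
  simp only [not_false_eq_true, Set.ofPred_true, Measure.restrict_apply_univ, volume_ivl,
    ENNReal.ofReal_eq_zero] at h1
  linarith [len_pos I]

theorem eavg_ne_zero {a : ℝ → ℝ} (ha : AEMeasurable a volume) (hpos : ∀ᵐ x, 0 < a x)
    (I : DyadicLabel) : eavg a I ≠ 0 :=
  ENNReal.div_ne_zero.2 ⟨lintegral_ivl_ne_zero ha hpos I, ENNReal.ofReal_ne_top⟩

theorem integrableOn_of_eavg_ne_top {a : ℝ → ℝ} (ha : AEMeasurable a volume)
    (hpos : ∀ᵐ x, 0 < a x) {I : DyadicLabel} (h : eavg a I ≠ ∞) :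
    IntegrableOn a (ivl I) volume := by
  refine ⟨ha.aestronglyMeasurable.restrict, (hasFiniteIntegral_iff_ofReal
    (ae_restrict_of_ae (hpos.mono fun _ hx => hx.le))).2 (lt_top_iff_ne_top.2 fun h0 => h ?_)⟩
  rw [eavg, h0, ENNReal.top_div_of_ne_top ENNReal.ofReal_ne_top]

/-- Neither average vanishes, as both functions are positive almost everywhere; a finite product
therefore forces both factors to be finite. -/
theorem integrableOn_of_jointConst_ne_top {t : ℝ} {u v w : ℝ → ℝ} (hu : IsWeight u)
    (hv : IsWeight v) (hw : IsWeight w) (h : jointConst t u v w ≠ ∞) (I : DyadicLabel) :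
    IntegrableOn (invW u) (ivl I) volume ∧ IntegrableOn (vw t v w) (ivl I) volume := by
  have h1 : eavg (invW u) I * eavg (vw t v w) I / ENNReal.ofReal ((avg w I) ^ (2 * t)) ≠ ∞ :=
    ne_top_of_le_ne_top h
      (le_iSup (fun I => eavg (invW u) I * eavg (vw t v w) I /
        ENNReal.ofReal ((avg w I) ^ (2 * t))) I)
  have h2 : eavg (invW u) I * eavg (vw t v w) I ≠ ∞ := fun h0 => h1 (by
    rw [h0, ENNReal.top_div_of_ne_top ENNReal.ofReal_ne_top])
  have hna := eavg_ne_zero (invW_aemeasurable hu) (invW_ae_pos hu) I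
  have hnb := eavg_ne_zero (vw_aemeasurable t hv hw) (vw_ae_pos t hv hw) I
  exact ⟨integrableOn_of_eavg_ne_top (invW_aemeasurable hu) (invW_ae_pos hu)
      fun h0 => h2 (by rw [h0, ENNReal.top_mul hnb]),
    integrableOn_of_eavg_ne_top (vw_aemeasurable t hv hw) (vw_ae_pos t hv hw)
      fun h0 => h2 (by rw [h0, ENNReal.mul_top hna])⟩

/-- The sum of `c` over the dyadic subintervals of `I`. -/
noncomputable def subSum (c : DyadicLabel → ℝ) (I : DyadicLabel) : ℝ≥0∞ :=
  ∑' J : {J : DyadicLabel // ivl J ⊆ ivl I}, ENNReal.ofReal (c J)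

/-- The interval `I`, those inside its left half and those inside its right half are disjoint
families. This supplies the superadditivity required of `m` in the Carleson embedding. -/
theorem subSum_split (c : DyadicLabel → ℝ) (I : DyadicLabel) :
    ENNReal.ofReal (c I) + subSum c (left I) + subSum c (right I) ≤ subSum c I := by
  have d1 : Disjoint {J | ivl J ⊆ ivl (left I)} {J | ivl J ⊆ ivl (right I)} := by
    rw [Set.disjoint_left]
    intro J h1 h2
    obtain ⟨x, hx⟩ := ivl_nonempty J
    exact Set.disjoint_left.1 (disjoint_ivl_left_right I) (h1 hx) (h2 hx)
  have d2 : Disjoint {I} ({J | ivl J ⊆ ivl (left I)} ∪ {J | ivl J ⊆ ivl (right I)}) := by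
    rw [Set.disjoint_singleton_left]
    rintro (h | h)
    · obtain ⟨x, hx⟩ := ivl_nonempty (right I)
      exact Set.disjoint_left.1 (disjoint_ivl_left_right I) (h (ivl_right_subset I hx)) hx
    · obtain ⟨x, hx⟩ := ivl_nonempty (left I)
      exact Set.disjoint_left.1 (disjoint_ivl_left_right I) hx (h (ivl_left_subset I hx))
  have h1 := Summable.tsum_union_disjoint (f := fun J => ENNReal.ofReal (c J)) d1
    ENNReal.summable ENNReal.summable
  have h2 := Summable.tsum_union_disjoint (f := fun J => ENNReal.ofReal (c J)) d2
    ENNReal.summable ENNReal.summable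
  rw [h1, tsum_singleton I (fun J => ENNReal.ofReal (c J)), ← add_assoc] at h2
  refine h2.symm.le.trans (ENNReal.tsum_mono_subtype (fun J => ENNReal.ofReal (c J)) ?_)
  rintro J (rfl | h | h)
  · exact Subset.rfl
  · exact h.trans (ivl_left_subset I)
  · exact h.trans (ivl_right_subset I)

theorem carleson_term_eq (t : ℝ) {w : ℝ → ℝ} (hw : IsWeight w) (a b : ℝ → ℝ) (J : DyadicLabel) :
    len J * |delta a J| ^ 2 * (avg b J / (avg w J) ^ (2 * t)) =
      4 * multCoeff t w J ^ 2 * ((∫ x in ivl (right J), a x) - ∫ x in ivl (left J), a x) ^ 2 *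
        ∫ x in ivl J, b x := by
  have hl := len_pos J
  have hW := Real.rpow_pos_of_pos (hw.avg_pos J) (2 * t)
  rw [sq_abs, delta_eq, avg_real, multCoeff_sq t hw]
  field_simp
  ring

/-- The infimum is attained: admissibility of `C` at `I` means that `C` dominates the fixed ratio of
the Carleson sum to `∫_I a`, and these bounds pass to the infimum. -/
theorem subSum_le_of_carlesonConst_ne_top {t : ℝ} {a b w : ℝ → ℝ} (ha : ∀ᵐ x, 0 < a x)
    (hint : ∀ I, IntegrableOn a (ivl I) volume) (h : carlesonConst t a b w ≠ ∞) (I : DyadicLabel) :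
    subSum (fun J => len J * |delta a J| ^ 2 * (avg b J / (avg w J) ^ (2 * t))) I ≤
      ENNReal.ofReal ((carlesonConst t a b w).toReal * ∫ x in ivl I, a x) := by
  have hl := len_pos I
  have hA := integral_ivl_pos ha (hint I)
  set S := subSum (fun J => len J * |delta a J| ^ 2 * (avg b J / (avg w J) ^ (2 * t))) I with hS
  have hl0 : ENNReal.ofReal (len I) ≠ 0 := by simpa using hl
  have hA0 : ENNReal.ofReal (∫ x in ivl I, a x) ≠ 0 := by simpa using hA
  have key : S / ENNReal.ofReal (∫ x in ivl I, a x) ≤ carlesonConst t a b w := by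
    refine le_sInf fun C hC => ?_
    have h1 : (ENNReal.ofReal (len I))⁻¹ * S ≤ C * eavg a I := hC I
    rw [eavg_eq ha (hint I), ENNReal.ofReal_div_of_pos hl] at h1
    rw [ENNReal.div_le_iff hA0 ENNReal.ofReal_ne_top]
    have h2 := mul_le_mul_right h1 (ENNReal.ofReal (len I))
    rw [← mul_assoc, ENNReal.mul_inv_cancel hl0 ENNReal.ofReal_ne_top, one_mul] at h2
    refine h2.trans (le_of_eq ?_)
    rw [← mul_assoc, mul_comm (ENNReal.ofReal (len I)), mul_assoc,
      ENNReal.mul_div_cancel hl0 ENNReal.ofReal_ne_top]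
  rw [ENNReal.div_le_iff hA0 ENNReal.ofReal_ne_top] at key
  rwa [ENNReal.ofReal_mul ENNReal.toReal_nonneg, ENNReal.ofReal_toReal h]

theorem carlesonConst_le {t : ℝ} {a b w : ℝ → ℝ} (ha : ∀ᵐ x, 0 < a x)
    (hint : ∀ I, IntegrableOn a (ivl I) volume) {C : ℝ} (hC : 0 ≤ C)
    (h : ∀ I, subSum (fun J => len J * |delta a J| ^ 2 * (avg b J / (avg w J) ^ (2 * t))) I ≤
      ENNReal.ofReal (C * ∫ x in ivl I, a x)) :
    carlesonConst t a b w ≤ ENNReal.ofReal C := by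
  refine sInf_le fun I => ?_
  have hl := len_pos I
  refine (mul_le_mul_right (h I) _).trans (le_of_eq ?_)
  rw [eavg_eq ha (hint I), ENNReal.ofReal_div_of_pos hl, ENNReal.ofReal_mul hC]
  rw [div_eq_mul_inv]
  ring

theorem rpow_half_eq {x : ℝ≥0∞} (hx : x ≠ ∞) : x ^ (1 / 2 : ℝ) = ENNReal.ofReal √x.toReal := by
  rw [Real.sqrt_eq_rpow, ← ENNReal.ofReal_rpow_of_nonneg ENNReal.toReal_nonneg (by norm_num),
    ENNReal.ofReal_toReal hx]

/-! ### Summation of the operator series -/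

/-- The signed term of the Haar multiplier as a linear map. -/
noncomputable def signedTerm {E H : Type*} [NormedAddCommGroup E] [InnerProductSpace ℂ E]
    [NormedAddCommGroup H] [InnerProductSpace ℂ H] (σ : DyadicLabel → ℤˣ) (s : DyadicLabel → ℝ)
    (i : DyadicLabel → E) (l : DyadicLabel → H) (I : DyadicLabel) : E →ₗ[ℂ] H where
  toFun f := ((σ I : ℤ) : ℂ) • haarRankOne s i l I f
  map_add' f g := by
    simp only [haarRankOne, inner_add_right, mul_add, add_smul, smul_add]
  map_smul' c f := by
    simp only [haarRankOne, inner_smul_right, smul_smul, RingHom.id_apply]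
    congr 1
    ring

/-- The term of the positive operator as a linear map. -/
noncomputable def positiveTerm {E H : Type*} [NormedAddCommGroup E] [InnerProductSpace ℂ E]
    [NormedAddCommGroup H] [InnerProductSpace ℂ H] (p : DyadicLabel → ℝ)
    (i : DyadicLabel → E) (l : DyadicLabel → H) (I : DyadicLabel) : E →ₗ[ℂ] H where
  toFun f := ((p I : ℂ) * inner ℂ (i I) f) • l I
  map_add' f g := by
    simp only [inner_add_right, mul_add, add_smul]
  map_smul' c f := by
    simp only [inner_smul_right, smul_smul, RingHom.id_apply]
    congr 1
    ring

/-- A bounded positive operator has a bounded positive bilinear form. -/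
theorem sum_positive_le {m₁ g₁ m₂ g₂ : ℝ → ℝ} (h₁ : IsTestPair m₁ g₁) (h₂ : IsTestPair m₂ g₂)
    {p : DyadicLabel → ℝ} (hp : ∀ I, 0 ≤ p I) {P : L2 m₁ →L[ℂ] L2 m₂}
    (hP : ∀ f, HasSum (fun I => positiveTerm p h₁.testVec h₂.testVec I f) (P f))
    (f : L2 m₁) (φ : L2 m₂) (F : Finset DyadicLabel) :
    ∑ I ∈ F, p I * ‖inner ℂ (h₁.testVec I) f‖ * ‖inner ℂ (h₂.testVec I) φ‖ ≤
      ‖P‖ * ‖f‖ * ‖φ‖ := by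
  -- Replacing `f` and `φ` by their absolute values preserves norms and makes every term of the form
  -- nonnegative, so a finite sum is at most the full form of `P`.
  obtain ⟨f', hf', hf⟩ := h₁.exists_dominating f
  obtain ⟨φ', hφ', hφ⟩ := h₂.exists_dominating φ
  choose r hr hrf using hf
  choose q hq hqf using hφ
  have hr0 : ∀ I, 0 ≤ r I := fun I => (norm_nonneg _).trans (hrf I)
  have hq0 : ∀ I, 0 ≤ q I := fun I => (norm_nonneg _).trans (hqf I)
  have hs : HasSum (fun I => p I * r I * q I) (inner ℂ φ' (P f')).re := by
    have := Complex.hasSum_re ((hP f').mapL (innerSL ℂ φ'))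
    rw [innerSL_apply_apply] at this
    convert this using 2 with I
    simp only [positiveTerm, LinearMap.coe_mk, AddHom.coe_mk, innerSL_apply_apply, inner_smul_right,
      hr]
    rw [← inner_conj_symm, hq, Complex.conj_ofReal]
    norm_cast
  calc _ ≤ ∑ I ∈ F, p I * r I * q I := Finset.sum_le_sum fun I _ => by
        have := hp I
        have := hr0 I
        gcongr
        · exact hrf I
        · exact hqf I
    _ ≤ (inner ℂ φ' (P f')).re := sum_le_hasSum F
        (fun I _ => mul_nonneg (mul_nonneg (hp I) (hr0 I)) (hq0 I)) hs
    _ ≤ ‖φ'‖ * ‖P f'‖ := (Complex.re_le_norm _).trans (norm_inner_le_norm _ _)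
    _ ≤ ‖φ'‖ * (‖P‖ * ‖f'‖) := by gcongr; exact P.le_opNorm f'
    _ = _ := by rw [hf', hφ']; ring

theorem subSum_majorant {c α : DyadicLabel → ℝ} {C : ℝ} (hc : ∀ I, 0 ≤ c I)
    (hα : ∀ I, 0 ≤ C * α I) (h : ∀ I, subSum c I ≤ ENNReal.ofReal (C * α I)) :
    (∀ I, (subSum c I).toReal ≤ C * α I) ∧
      ∀ I, c I + (subSum c (left I)).toReal + (subSum c (right I)).toReal ≤ (subSum c I).toReal := by
  have hfin : ∀ I, subSum c I ≠ ∞ := fun I => ne_top_of_le_ne_top ENNReal.ofReal_ne_top (h I)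
  refine ⟨fun I => ENNReal.toReal_le_of_le_ofReal (hα I) (h I), fun I => ?_⟩
  have := ENNReal.toReal_mono (hfin I) (subSum_split c I)
  rwa [ENNReal.toReal_add (ENNReal.add_ne_top.2 ⟨ENNReal.ofReal_ne_top, hfin _⟩) (hfin _),
    ENNReal.toReal_add ENNReal.ofReal_ne_top (hfin _), ENNReal.toReal_ofReal (hc I)] at this

/-! ### The two-sided estimate -/

section

variable {t : ℝ} {u v w : ℝ → ℝ}

theorem constSum_lt_top_iff : constSum t u v w < ∞ ↔
    (jointConst t u v w < ∞ ∧ C₂ t u v w < ∞ ∧ C₃ t u v w < ∞ ∧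
      IsBoundedOp (posTerm t u v w) u v) := by
  simp only [constSum, ENNReal.add_lt_top, ENNReal.rpow_lt_top_iff_of_pos
    (show (0 : ℝ) < 1 / 2 by norm_num), opNorm_lt_top_iff, and_assoc]

theorem opNorm_haarTerm_le (hu : IsWeight u) (hv : IsWeight v) (hw : IsWeight w)
    (σ : DyadicLabel → ℤˣ) : opNorm (haarTerm t w σ) u v ≤ constSum t u v w := by
  by_cases htop : constSum t u v w = ∞
  · rw [htop]; exact le_top
  obtain ⟨h1, h2, h3, P, hP⟩ := constSum_lt_top_iff.1 (lt_top_iff_ne_top.2 htop)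
  replace h1 := h1.ne
  replace h2 := h2.ne
  replace h3 := h3.ne
  have ha := fun I => (integrableOn_of_jointConst_ne_top hu hv hw h1 I).1
  have hb := fun I => (integrableOn_of_jointConst_ne_top hu hv hw h1 I).2
  have hi := isTestPair_invW hu ha
  have hl := isTestPair_rpow hv hw hb
  have hs : ∀ I, 0 ≤ multCoeff t w I := fun I => (multCoeff_pos t hw I).le
  rw [represents_iff (integrableOn_of_L2 hu ha) (posTerm_ae_eq hu hv hw ha hb)] at hP
  have hC1 : ∀ I, multCoeff t w I ^ 2 * ‖hi.testVec I‖ ^ 2 * ‖hl.testVec I‖ ^ 2 ≤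
      (jointConst t u v w).toReal := by
    intro I
    rw [norm_sq_testVec_invW hu ha, norm_sq_testVec_rpow hv hw hb]
    refine (ENNReal.ofReal_le_iff_le_toReal h1).1 ?_
    rw [← joint_term_eq hu hv hw (ha I) (hb I)]
    exact le_iSup (fun I => eavg (invW u) I * eavg (vw t v w) I /
      ENNReal.ofReal ((avg w I) ^ (2 * t))) I
  have hc2 : ∀ J, len J * |delta (invW u) J| ^ 2 * (avg (vw t v w) J / (avg w J) ^ (2 * t)) =
      4 * multCoeff t w J ^ 2 * massDiff hi.testVec J ^ 2 * ‖hl.testVec J‖ ^ 2 := fun J => by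
    rw [carleson_term_eq t hw, massDiff, norm_sq_testVec_invW hu ha, norm_sq_testVec_invW hu ha,
      norm_sq_testVec_rpow hv hw hb]
  have hc3 : ∀ J, len J * |delta (vw t v w) J| ^ 2 * (avg (invW u) J / (avg w J) ^ (2 * t)) =
      4 * multCoeff t w J ^ 2 * massDiff hl.testVec J ^ 2 * ‖hi.testVec J‖ ^ 2 := fun J => by
    rw [carleson_term_eq t hw, massDiff, norm_sq_testVec_rpow hv hw hb,
      norm_sq_testVec_rpow hv hw hb, norm_sq_testVec_invW hu ha]
  have hS2 := subSum_le_of_carlesonConst_ne_top (invW_ae_pos hu) ha h2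
  have hS3 := subSum_le_of_carlesonConst_ne_top (vw_ae_pos t hv hw) hb h3
  simp only [hc2, ← norm_sq_testVec_invW hu ha] at hS2
  simp only [hc3, ← norm_sq_testVec_rpow hv hw hb] at hS3
  obtain ⟨hm, hcm⟩ := subSum_majorant (fun I => by positivity) (fun I => by positivity) hS2
  obtain ⟨hn, hcn⟩ := subSum_majorant (fun I => by positivity) (fun I => by positivity) hS3
  have hbil := fun f φ F => hi.dyadicSystem.sum_coeff_mul_coeff_le hl.dyadicSystem hs
    (ENNReal.toReal_nonneg (a := jointConst t u v w)) (ENNReal.toReal_nonneg (a := C₂ t u v w))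
    (ENNReal.toReal_nonneg (a := C₃ t u v w)) hC1 (fun I => ENNReal.toReal_nonneg) hm hcm
    (fun I => ENNReal.toReal_nonneg) hn hcn f φ F
    (sum_positive_le hi hl (posCoeff_nonneg hs _ _) hP f φ F)
  set X := √(jointConst t u v w).toReal + √(C₂ t u v w).toReal + √(C₃ t u v w).toReal + ‖P‖ with hX
  have hX0 : 0 ≤ X := by positivity
  -- The bound `hbil` is on absolute values, so it controls the partial sums for this `σ`, and
  -- boundedness of all finite partial sums already yields unconditional convergence.
  obtain ⟨L, hLX, hL⟩ := exists_clm_hasSum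
    (signedTerm σ (multCoeff t w) hi.testVec hl.testVec) hX0 (fun F f => by
      simp only [signedTerm, LinearMap.coe_mk, AddHom.coe_mk, haarRankOne, smul_smul]
      refine norm_sum_smul_le (by positivity) fun φ => ?_
      refine le_of_eq_of_le (Finset.sum_congr rfl fun I _ => ?_) ((hbil f φ F).trans_eq (by ring))
      have hσ : ‖((σ I : ℤ) : ℂ)‖ = 1 := by
        rcases Int.units_eq_one_or (σ I) with h | h <;> simp [h]
      rw [norm_mul, norm_mul, hσ, one_mul, Complex.norm_real, Real.norm_of_nonneg (hs I)])
  have hrep : Represents (haarTerm t w σ) u v L :=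
    (represents_iff (integrableOn_of_L2 hu ha) (haarTerm_ae_eq hu hv hw ha hb σ) L).2 hL
  have hPrep : opNorm (posTerm t u v w) u v = ‖P‖ₑ := Represents.opNorm_eq
    ((represents_iff (integrableOn_of_L2 hu ha) (posTerm_ae_eq hu hv hw ha hb) P).2 hP)
  rw [hrep.opNorm_eq, constSum, hPrep, rpow_half_eq h1, rpow_half_eq h2, rpow_half_eq h3,
    ← ofReal_norm, ← ofReal_norm, ← ENNReal.ofReal_add (by positivity) (by positivity),
    ← ENNReal.ofReal_add (by positivity) (by positivity),
    ← ENNReal.ofReal_add (by positivity) (by positivity)]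
  exact ENNReal.ofReal_le_ofReal hLX

/-- The Carleson sums are controlled by testing the signed multipliers on indicators. -/
theorem subSum_le_of_signedBound {m₁ g₁ m₂ g₂ : ℝ → ℝ} (h₁ : IsTestPair m₁ g₁)
    (h₂ : IsTestPair m₂ g₂) {s : DyadicLabel → ℝ} {M : ℝ}
    (h : SignedBound s h₁.testVec h₂.testVec M) (I : DyadicLabel) :
    subSum (fun J => 4 * s J ^ 2 * massDiff h₁.testVec J ^ 2 * ‖h₂.testVec J‖ ^ 2) I ≤
      ENNReal.ofReal ((2 * M) ^ 2 * ‖h₁.testVec I‖ ^ 2) := by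
  rw [subSum, ENNReal.tsum_eq_iSup_sum]
  refine iSup_le fun F => ?_
  rw [← ENNReal.ofReal_sum_of_nonneg (fun J _ => by positivity)]
  refine ENNReal.ofReal_le_ofReal ?_
  -- Testing on the vector of `I`: for `J ⊆ I` its pairing with each half of `J` is the mass of that
  -- half, so the coefficient is `massDiff`.
  have key := h.sum_sq_le h₂.dyadicSystem (F.map (Function.Embedding.subtype _)) (h₁.testVec I)
  rw [Finset.sum_map] at key
  have e : ∀ J : {J : DyadicLabel // ivl J ⊆ ivl I},
      ‖inner ℂ (h₁.testVec (right J) - h₁.testVec (left J)) (h₁.testVec I)‖ ^ 2 =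
        massDiff h₁.testVec J ^ 2 := by
    intro J
    rw [inner_sub_left, h₁.inner_testVec_of_subset ((ivl_right_subset J).trans J.2),
      h₁.inner_testVec_of_subset ((ivl_left_subset J).trans J.2), ← Complex.ofReal_sub,
      Complex.norm_real, Real.norm_eq_abs, sq_abs, massDiff]
  simp only [Function.Embedding.subtype_apply, e] at key
  calc _ = 4 * ∑ J ∈ F, s J ^ 2 * massDiff h₁.testVec J ^ 2 * ‖h₂.testVec J‖ ^ 2 := by
        rw [Finset.mul_sum]
        exact Finset.sum_congr rfl fun J _ => by ring
    _ ≤ 4 * (M * ‖h₁.testVec I‖) ^ 2 := by gcongr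
    _ = _ := by ring

/-- The constant is `25 = 1 + 2 + 2 + 20`: the joint condition costs `M`, each Carleson root `2M`,
and the positive operator `20M`. -/
theorem constSum_le_of_bounds (hu : IsWeight u) (hv : IsWeight v) (hw : IsWeight w) {M : ℝ}
    (hM : 0 ≤ M) (h : ∀ σ, ∃ L, Represents (haarTerm t w σ) u v L ∧ ‖L‖ ≤ M) :
    constSum t u v w ≤ 25 * ENNReal.ofReal M := by
  have ha := fun I => (integrableOn_of_bounds hu hv hw (norm_haarTerm_le h I)).1
  have hb := fun I => (integrableOn_of_bounds hu hv hw (norm_haarTerm_le h I)).2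
  have hi := isTestPair_invW hu ha
  have hl := isTestPair_rpow hv hw hb
  have hs : ∀ I, 0 ≤ multCoeff t w I := fun I => (multCoeff_pos t hw I).le
  have hSB : SignedBound (multCoeff t w) hi.testVec hl.testVec M := by
    intro F e f
    refine norm_signed_sum_le (fun σ => ?_) F e
    obtain ⟨L, hL, hLM⟩ := h σ
    rw [represents_iff (integrableOn_of_L2 hu ha) (haarTerm_ae_eq hu hv hw ha hb σ)] at hL
    exact ⟨L f, hL f, (L.le_opNorm f).trans (by gcongr)⟩
  have hC1 : jointConst t u v w ≤ ENNReal.ofReal (M ^ 2) := by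
    refine iSup_le fun I => ?_
    rw [joint_term_eq hu hv hw (ha I) (hb I), ← norm_sq_testVec_invW hu ha,
      ← norm_sq_testVec_rpow hv hw hb]
    exact ENNReal.ofReal_le_ofReal
      (hSB.sq_mul_norm_sq_mul_norm_sq_le hi.dyadicSystem hl.dyadicSystem I)
  have hC2 : C₂ t u v w ≤ ENNReal.ofReal ((2 * M) ^ 2) := by
    refine carlesonConst_le (invW_ae_pos hu) ha (by positivity) fun I => ?_
    have := subSum_le_of_signedBound hi hl hSB I
    simpa only [carleson_term_eq t hw, massDiff, norm_sq_testVec_invW hu ha,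
      norm_sq_testVec_rpow hv hw hb] using this
  have hC3 : C₃ t u v w ≤ ENNReal.ofReal ((2 * M) ^ 2) := by
    refine carlesonConst_le (vw_ae_pos t hv hw) hb (by positivity) fun I => ?_
    have := subSum_le_of_signedBound hl hi (hSB.dual hM) I
    simpa only [carleson_term_eq t hw, massDiff, norm_sq_testVec_invW hu ha,
      norm_sq_testVec_rpow hv hw hb] using this
  have hC4 : opNorm (posTerm t u v w) u v ≤ ENNReal.ofReal (20 * M) := by
    obtain ⟨P, hPM, hP⟩ := exists_clm_hasSum
      (positiveTerm (posCoeff (multCoeff t w) hi.testVec hl.testVec) hi.testVec hl.testVec)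
      (C := 20 * M) (by positivity) (fun F f => by
        simp only [positiveTerm, LinearMap.coe_mk, AddHom.coe_mk]
        refine norm_sum_smul_le (by positivity) fun φ => ?_
        refine le_of_eq_of_le (Finset.sum_congr rfl fun I _ => ?_)
          ((hSB.sum_posCoeff_le hM hs hi.dyadicSystem hl.dyadicSystem F f φ).trans_eq (by ring))
        rw [norm_mul, Complex.norm_real, Real.norm_of_nonneg (posCoeff_nonneg hs _ _ I)])
    have hrep : Represents (posTerm t u v w) u v P :=
      (represents_iff (integrableOn_of_L2 hu ha) (posTerm_ae_eq hu hv hw ha hb) P).2 hP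
    rw [hrep.opNorm_eq, ← ofReal_norm]
    exact ENNReal.ofReal_le_ofReal hPM
  have half : ∀ {x : ℝ≥0∞} {y : ℝ}, 0 ≤ y → x ≤ ENNReal.ofReal (y ^ 2) →
      x ^ (1 / 2 : ℝ) ≤ ENNReal.ofReal y := by
    intro x y hy hx
    refine (ENNReal.rpow_le_rpow hx (by norm_num)).trans (le_of_eq ?_)
    rw [rpow_half_eq ENNReal.ofReal_ne_top, ENNReal.toReal_ofReal (by positivity),
      Real.sqrt_sq hy]
  calc constSum t u v w ≤ ENNReal.ofReal M + ENNReal.ofReal (2 * M) + ENNReal.ofReal (2 * M) +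
        ENNReal.ofReal (20 * M) := by
        rw [constSum]
        gcongr
        · exact half hM hC1
        · exact half (by positivity) hC2
        · exact half (by positivity) hC3
    _ = ENNReal.ofReal (25 * M) := by
        rw [← ENNReal.ofReal_add (by positivity) (by positivity),
          ← ENNReal.ofReal_add (by positivity) (by positivity),
          ← ENNReal.ofReal_add (by positivity) (by positivity)]
        congr 1
        ring
    _ = _ := by rw [ENNReal.ofReal_mul (by norm_num)]; norm_num

theorem constSum_le_iSup (hu : IsWeight u) (hv : IsWeight v) (hw : IsWeight w) :
    constSum t u v w ≤ 25 * ⨆ σ : DyadicLabel → ℤˣ, opNorm (haarTerm t w σ) u v := by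
  by_cases htop : (⨆ σ : DyadicLabel → ℤˣ, opNorm (haarTerm t w σ) u v) = ∞
  · rw [htop, ENNReal.mul_top (by norm_num)]
    exact le_top
  rw [← ENNReal.ofReal_toReal htop]
  refine constSum_le_of_bounds hu hv hw ENNReal.toReal_nonneg fun σ => ?_
  have hσ := le_iSup (fun σ : DyadicLabel → ℤˣ => opNorm (haarTerm t w σ) u v) σ
  obtain ⟨L, hL⟩ := opNorm_lt_top_iff.1 (lt_top_iff_ne_top.2 (ne_top_of_le_ne_top htop hσ))
  refine ⟨L, hL, ?_⟩
  rw [← ENNReal.ofReal_le_iff_le_toReal htop, ofReal_norm, ← hL.opNorm_eq]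
  exact hσ

theorem uniformlyBounded_iff (hu : IsWeight u) (hv : IsWeight v) (hw : IsWeight w) :
    UniformlyBounded t u v w ↔ constSum t u v w < ∞ := by
  constructor
  · rintro ⟨C, hC⟩
    exact (constSum_le_of_bounds hu hv hw C.2 hC).trans_lt
      (ENNReal.mul_lt_top (by norm_num) ENNReal.ofReal_lt_top)
  · intro h
    refine ⟨(constSum t u v w).toNNReal, fun σ => ?_⟩
    have hσ := opNorm_haarTerm_le (t := t) hu hv hw σ
    obtain ⟨L, hL⟩ := opNorm_lt_top_iff.1 (hσ.trans_lt h)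
    refine ⟨L, hL, ?_⟩
    rw [hL.opNorm_eq, ← ofReal_norm] at hσ
    exact (ENNReal.ofReal_le_iff_le_toReal h.ne).1 hσ

end

end THaar

theorem theorem1p1 :
    ∃ c K : ℝ≥0, 0 < c ∧ 0 < K ∧
      ∀ (t : ℝ) (u v w : ℝ → ℝ), THaar.IsWeight u → THaar.IsWeight v → THaar.IsWeight w →
        (THaar.UniformlyBounded t u v w ↔
          (THaar.jointConst t u v w < ∞ ∧ THaar.C₂ t u v w < ∞ ∧ THaar.C₃ t u v w < ∞ ∧
            THaar.IsBoundedOp (THaar.posTerm t u v w) u v)) ∧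
        (∀ σ : THaar.DyadicLabel → ℤˣ,
          THaar.opNorm (THaar.haarTerm t w σ) u v ≤ K * THaar.constSum t u v w) ∧
        (c * THaar.constSum t u v w ≤
          ⨆ σ : THaar.DyadicLabel → ℤˣ, THaar.opNorm (THaar.haarTerm t w σ) u v) := by
  refine ⟨25⁻¹, 1, by positivity, one_pos, fun t u v w hu hv hw => ⟨?_, fun σ => ?_, ?_⟩⟩
  · rw [THaar.uniformlyBounded_iff hu hv hw, THaar.constSum_lt_top_iff]
  · rw [ENNReal.coe_one, one_mul]
    exact THaar.opNorm_haarTerm_le hu hv hw σ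
  · refine (mul_le_mul_right (THaar.constSum_le_iSup hu hv hw) _).trans (le_of_eq ?_)
    rw [← mul_assoc, ENNReal.coe_inv (by norm_num), ENNReal.coe_ofNat,
      ENNReal.inv_mul_cancel (by norm_num) (by norm_num), one_mul]
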